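/- **A priori error estimate for the iterated penalty method (IPM).** *Setting.* Let $d\ge 2$ and let $\Omega\subset\mathbb R^d$ be a bounded domain with polyhedral Lipschitz boundary and outer unit normal $n$. Put $H^1_\sim(\Omega)=\{v\in H^1(\Omega)^d:\int_{\partial\Omega}\mathrm{tr}(v)\cdot n\,d\sigma=0\}$, $H^1_{\mathrm{div}}(\Omega)=\{v\in H^1(\Omega)^d:\operatorname{div}v=0\}$, and let $L^2_0(\Omega)$ be the mean-free functions in $L^2(\Omega)$; $\langle\cdot,\cdot\rangle$ and $\|\cdot\|$ denote the $L^2(\Omega)$ inner product and norm (Frobenius for matrix fields), and also the duality of $H^{-1}(\Omega)^d$ and $H^1_0(\Omega)^d$. Let $\nu>0$, $f\in H^{-1}(\Omega)^d$, $g\in H^1_\sim(\Omega)$, and let $(u,p)\in H^1_{\mathrm{div}}(\Omega)\times L^2_0(\Omega)$ be the weak solution of the Stokes problem $$\nu\langle\nabla u,\nabla v\rangle-\langle p,\operatorname{div}v\rangle=\langle f,v\rangle\ \ \forall v\in H^1_0(\Omega)^d,\qquad \langle\operatorname{div}u,q\rangle=0\ \ \forall q\in L^2_0(\Omega),\qquad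 \mathrm{tr}(u)=\mathrm{tr}(g).$$ *Discretisation.* Let $(\mathcal T_h)_h$ be a shape-regular family of conforming simplicial triangulations of $\overline\Omega$ and $k\in\mathbb N$. Let $X_h$ be the space of continuous $\mathbb R^d$-valued functions on $\overline\Omega$ that are polynomial of degree at most $k$ on each simplex of $\mathcal T_h$, and let $X_{h,\sim}=X_h\cap H^1_\sim(\Omega)$, $V_h=X_h\cap H^1_0(\Omega)^d$ and $Q_h=\operatorname{div}X_{h,\sim}$ (Scott–Vogelius element). Assume that $\operatorname{div}V_h=\operatorname{div}X_{h,\sim}$ for all $h$ and that, for some $\overline\beta>0$, $$\overline\beta\,\|q_h\|\le\sup_{v_h\in V_h\setminus\{0\}}\frac{\langle\operatorname{div}v_h,q_h\rangle}{\|\nabla v_h\|}\qquad\text{for all }q_h\in Q_h\text{ and all }h.$$ *Operators.* Let $\Pi_h, I_h\colon H^1(\Omega)^d\to X_h$ be linear operators and $c_F,c_I>0$ such that for all $h$ and all $v\in H^1(\Omega)^d$: (1) $\langle\operatorname{div}\Pi_hv,q_h\rangle=\langle\operatorname{div}v,q_h\rangle$ for all $q_h\in Q_h$; (2) $\|\nabla\Pi_hv\|\le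 c_F\|\nabla v\|$ and $\|\nabla I_hv\|\le c_I\|\nabla v\|$; (3) if $\mathrm{tr}(v)\in\mathrm{tr}(X_h)$, then $\mathrm{tr}(\Pi_hv)=\mathrm{tr}(I_hv)=\mathrm{tr}(v)$; (4) $\Pi_h(H^1_\sim(\Omega))\subset X_{h,\sim}$ and $\int_{\partial\Omega}\mathrm{tr}(v-I_hv)\cdot n\,d\sigma=0$. Let $g_h\in X_h$ with $\mathrm{tr}(g_h)=\mathrm{tr}(I_hg)=\mathrm{tr}(\Pi_hg)$. *IPM.* Let $\rho>0$ and $\varphi_{h,0}=0$. For $i=1,2,\dots$ let $u_{h,i}\in X_{h,\sim}$ with $\mathrm{tr}(u_{h,i})=\mathrm{tr}(g_h)$ satisfy $$\nu\langle\nabla u_{h,i},\nabla v_h\rangle+\rho\langle\operatorname{div}u_{h,i},\operatorname{div}v_h\rangle=\langle f,v_h\rangle+\langle\operatorname{div}\varphi_{h,i-1},\operatorname{div}v_h\rangle\quad\forall v_h\in V_h,$$ and let $\varphi_{h,i}=\varphi_{h,i-1}-\rho\,u_{h,i}$. *Claim.* Put $$\theta=\frac{\nu}{\nu+\rho\overline\beta^2},\qquad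 c_1=2(1+c_I)+\sqrt{\tfrac d2}\,\sqrt{\tfrac{\rho}{2\nu}}\;c_I,\qquad c_2=\frac1{\sqrt{2\rho\nu}}.$$ Then, for all $h$ and all $i\ge1$, $$\|\nabla u-\nabla u_{h,i}\|\le 2(1+c_F)\inf_{v_h\in X_h}\|\nabla u-\nabla v_h\|+\theta^{i-1}\inf_{v_h\in X_h}\bigl(c_1\|\nabla u-\nabla v_h\|+c_2\|p+\rho\operatorname{div}v_h\|\bigr),$$ $$\|p-\operatorname{div}\varphi_{h,i}\|\le 2\nu(1+c_F)\overline\beta^{-1}\inf_{v_h\in X_h}\|\nabla u-\nabla v_h\|+\inf_{q_h\in Q_h}\|p-q_h\|+\tfrac{\nu+\rho\overline\beta}{\overline\beta}\,\theta^{i-1}\inf_{v_h\in X_h}\bigl(c_1\|\nabla u-\nabla v_h\|+c_2\|p+\rho\operatorname{div}v_h\|\bigr).$$ Moreover, the only pressure-dependent term in the velocity estimate, $\theta^{i-1}\inf_{v_h\in X_h}\bigl(c_1\|\nabla u-\nabla v_h\|+c_2\|p+\rho\operatorname{div}v_h\|\bigr)$, tends to $0$ as $i\to\infty$, i.e. the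 velocity estimate is asymptotically pressure-robust. -/

import Mathlib

open MeasureTheory Filter Topology Set
open scoped ContDiff RealInnerProductSpace

noncomputable section

namespace StokesIPM

/-- Points and vectors of `ℝ^d`, with the Euclidean norm. -/
abbrev Vec (d : ℕ) := EuclideanSpace ℝ (Fin d)

/-- Real `d × d` matrices, with the Frobenius norm and inner product. -/
abbrev Mat (d : ℕ) := EuclideanSpace ℝ (Fin d × Fin d)

variable {d : ℕ}

/-! ### Domains -/

/-- A bounded domain (nonempty, open, connected) with Lipschitz boundary: near each boundary point
`x`, the set `Ω` is the strict epigraph, in some unit direction `e`, of a Lipschitz function `γ` of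
the component orthogonal to `e`. -/
structure IsLipschitzDomain (Ω : Set (Vec d)) : Prop where
  isOpen : IsOpen Ω
  isConnected : IsConnected Ω
  isBounded : Bornology.IsBounded Ω
  boundary : ∀ x ∈ frontier Ω, ∃ r > 0, ∃ e : Vec d, ‖e‖ = 1 ∧ ∃ γ : Vec d → ℝ,
    (∃ K, LipschitzWith K γ) ∧ (∀ (y : Vec d) (t : ℝ), γ (y + t • e) = γ y) ∧
      ∀ y ∈ Metric.ball x r, y ∈ Ω ↔ γ y < ⟪e, y⟫

/-! ### Lebesgue and Sobolev spaces -/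

/-- `L²(Ω; F)`. -/
abbrev L2 (Ω : Set (Vec d)) (F : Type*) [NormedAddCommGroup F] :=
  Lp F 2 ((volume : Measure (Vec d)).restrict Ω)

/-- A scalar test function `φ ∈ C_c^∞(Ω)`. -/
def IsTestFunction (Ω : Set (Vec d)) (φ : Vec d → ℝ) : Prop :=
  ContDiff ℝ ∞ φ ∧ HasCompactSupport φ ∧ tsupport φ ⊆ Ω

/-- The partial derivative `∂_j φ`. -/
def partialDeriv (j : Fin d) (φ : Vec d → ℝ) (x : Vec d) : ℝ :=
  fderiv ℝ φ x (EuclideanSpace.single j 1)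

/-- `G` is the weak gradient of `u` on `Ω`, with `G_{ij} = ∂_j u_i`. -/
def IsWeakGradient (Ω : Set (Vec d)) (u : Vec d → Vec d) (G : Vec d → Mat d) : Prop :=
  ∀ φ : Vec d → ℝ, IsTestFunction Ω φ → ∀ i j : Fin d,
    ∫ x in Ω, u x i * partialDeriv j φ x = - ∫ x in Ω, G x (i, j) * φ x

lemma memLp_coord {Ω : Set (Vec d)} {κ : Type*} [Fintype κ] (u : L2 Ω (EuclideanSpace ℝ κ))
    (i : κ) : MemLp (fun x => u x i) 2 ((volume : Measure (Vec d)).restrict Ω) :=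
  (EuclideanSpace.proj (𝕜 := ℝ) i : EuclideanSpace ℝ κ →L[ℝ] ℝ).comp_memLp' (Lp.memLp u)

lemma IsTestFunction.memLp {Ω : Set (Vec d)} {φ : Vec d → ℝ} (h : IsTestFunction Ω φ) :
    MemLp φ 2 ((volume : Measure (Vec d)).restrict Ω) :=
  (h.1.continuous.memLp_of_hasCompactSupport h.2.1).restrict Ω

lemma IsTestFunction.memLp_partialDeriv {Ω : Set (Vec d)} {φ : Vec d → ℝ}
    (h : IsTestFunction Ω φ) (j : Fin d) :
    MemLp (partialDeriv j φ) 2 ((volume : Measure (Vec d)).restrict Ω) := by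
  have hc : Continuous (partialDeriv j φ) :=
    (h.1.continuous_fderiv (by simp)).clm_apply continuous_const
  have hs : HasCompactSupport (partialDeriv j φ) := h.2.1.fderiv_apply ℝ _
  exact (hc.memLp_of_hasCompactSupport hs).restrict Ω

/-- The space `H¹(Ω)^d`, realised as the graph of the weak gradient: pairs `(u, ∇u)` in
`L²(Ω)^d × L²(Ω)^{d×d}`, with norm `(‖u‖² + ‖∇u‖²)^{1/2}`. -/
def H1 (Ω : Set (Vec d)) : Submodule ℝ (WithLp 2 (L2 Ω (Vec d) × L2 Ω (Mat d))) where
  carrier := {w | IsWeakGradient Ω w.fst w.snd}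
  zero_mem' := by
    intro φ _ i j
    have h1 : ∫ x in Ω, (0 : L2 Ω (Vec d)) x i * partialDeriv j φ x = ∫ x in Ω, (0 : ℝ) := by
      refine integral_congr_ae ?_
      filter_upwards [Lp.coeFn_zero (Vec d) 2 ((volume : Measure (Vec d)).restrict Ω)] with x hx
      rw [hx]
      simp
    have h2 : ∫ x in Ω, (0 : L2 Ω (Mat d)) x (i, j) * φ x = ∫ x in Ω, (0 : ℝ) := by
      refine integral_congr_ae ?_
      filter_upwards [Lp.coeFn_zero (Mat d) 2 ((volume : Measure (Vec d)).restrict Ω)] with x hx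
      rw [hx]
      simp
    simp only [WithLp.zero_fst, WithLp.zero_snd]
    rw [h1, h2]
    simp
  add_mem' := by
    intro v w hv hw φ hφ i j
    have h1 : ∫ x in Ω, (v.fst + w.fst) x i * partialDeriv j φ x
        = (∫ x in Ω, v.fst x i * partialDeriv j φ x)
          + ∫ x in Ω, w.fst x i * partialDeriv j φ x := by
      refine Eq.trans ?_
        (integral_add ((memLp_coord v.fst i).integrable_mul (hφ.memLp_partialDeriv j))
          ((memLp_coord w.fst i).integrable_mul (hφ.memLp_partialDeriv j)))
      refine integral_congr_ae ?_
      filter_upwards [Lp.coeFn_add v.fst w.fst] with x hx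
      simp only [hx, Pi.add_apply, PiLp.add_apply, add_mul]
    have h2 : ∫ x in Ω, (v.snd + w.snd) x (i, j) * φ x
        = (∫ x in Ω, v.snd x (i, j) * φ x) + ∫ x in Ω, w.snd x (i, j) * φ x := by
      refine Eq.trans ?_
        (integral_add ((memLp_coord v.snd (i, j)).integrable_mul hφ.memLp)
          ((memLp_coord w.snd (i, j)).integrable_mul hφ.memLp))
      refine integral_congr_ae ?_
      filter_upwards [Lp.coeFn_add v.snd w.snd] with x hx
      simp only [hx, Pi.add_apply, PiLp.add_apply, add_mul]
    simp only [WithLp.add_fst, WithLp.add_snd]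
    rw [h1, h2, hv φ hφ i j, hw φ hφ i j]
    ring
  smul_mem' := by
    intro c w hw φ hφ i j
    have h1 : ∫ x in Ω, (c • w.fst) x i * partialDeriv j φ x
        = c * ∫ x in Ω, w.fst x i * partialDeriv j φ x := by
      rw [← integral_const_mul]
      refine integral_congr_ae ?_
      filter_upwards [Lp.coeFn_smul c w.fst] with x hx
      simp [hx, mul_assoc]
    have h2 : ∫ x in Ω, (c • w.snd) x (i, j) * φ x
        = c * ∫ x in Ω, w.snd x (i, j) * φ x := by
      rw [← integral_const_mul]
      refine integral_congr_ae ?_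
      filter_upwards [Lp.coeFn_smul c w.snd] with x hx
      simp [hx, mul_assoc]
    simp only [WithLp.smul_fst, WithLp.smul_snd]
    rw [h1, h2, hw φ hφ i j]
    ring

variable {Ω : Set (Vec d)}

/-- The function `v` underlying an element of `H¹(Ω)^d`. -/
def fn : H1 Ω →ₗ[ℝ] L2 Ω (Vec d) where
  toFun v := v.1.fst
  map_add' _ _ := rfl
  map_smul' _ _ := rfl

/-- The weak gradient `∇v ∈ L²(Ω)^{d×d}`. -/
def grad : H1 Ω →ₗ[ℝ] L2 Ω (Mat d) where
  toFun v := v.1.snd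
  map_add' _ _ := rfl
  map_smul' _ _ := rfl

/-- The trace of a matrix, as a continuous linear map. -/
def matTrace : Mat d →L[ℝ] ℝ := ∑ i : Fin d, EuclideanSpace.proj (𝕜 := ℝ) (i, i)

/-- The weak divergence `div v ∈ L²(Ω)`. -/
def dvg : H1 Ω →ₗ[ℝ] L2 Ω ℝ :=
  (matTrace.compLpL 2 ((volume : Measure (Vec d)).restrict Ω)).toLinearMap ∘ₗ grad

/-- The elements of `H¹(Ω)^d` given by vector fields in `C_c^∞(Ω)^d`. -/
def testFields (Ω : Set (Vec d)) : Submodule ℝ (H1 Ω) where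
  carrier := {v | ∃ φ : Vec d → Vec d, (∀ i, IsTestFunction Ω fun x => φ x i) ∧
    fn v =ᵐ[volume.restrict Ω] φ}
  zero_mem' := by
    refine ⟨0, fun i => ⟨by simpa using contDiff_const, ?_, ?_⟩, ?_⟩
    · exact HasCompactSupport.zero
    · have : tsupport (fun _ : Vec d => (0 : ℝ)) = ∅ := tsupport_eq_empty_iff.2 rfl
      simp [this]
    · rw [map_zero]
      exact Lp.coeFn_zero _ _ _
  add_mem' := by
    rintro v w ⟨φ, hφ, hv⟩ ⟨ψ, hψ, hw⟩
    refine ⟨φ + ψ, fun i => ⟨(hφ i).1.add (hψ i).1, (hφ i).2.1.add (hψ i).2.1, ?_⟩, ?_⟩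
    · exact (tsupport_add (fun x => φ x i) (fun x => ψ x i)).trans
        (union_subset (hφ i).2.2 (hψ i).2.2)
    · rw [map_add]
      exact (Lp.coeFn_add _ _).trans (hv.add hw)
  smul_mem' := by
    rintro c v ⟨φ, hφ, hv⟩
    refine ⟨c • φ, fun i => ⟨contDiff_const.mul (hφ i).1, (hφ i).2.1.mul_left, ?_⟩, ?_⟩
    · exact (tsupport_mul_subset_right (f := fun _ : Vec d => c)).trans (hφ i).2.2
    · rw [map_smul]
      exact (Lp.coeFn_smul _ _).trans (hv.const_smul c)

/-- `H¹₀(Ω)^d`, the closure of `C_c^∞(Ω)^d` in `H¹(Ω)^d`. -/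
def H10 (Ω : Set (Vec d)) : Submodule ℝ (H1 Ω) := (testFields Ω).topologicalClosure

/-- `H^{-1}(Ω)^d`, the dual space of `H¹₀(Ω)^d`. -/
abbrev Hneg1 (Ω : Set (Vec d)) := H10 Ω →L[ℝ] ℝ

/-- `L²₀(Ω)`, the functions in `L²(Ω)` with zero mean. -/
def L20 (Ω : Set (Vec d)) : Set (L2 Ω ℝ) := {q | ⨍ x in Ω, q x = 0}

/-- `H¹_div(Ω)`, the divergence-free functions in `H¹(Ω)^d`. -/
def H1div (Ω : Set (Vec d)) : Submodule ℝ (H1 Ω) := LinearMap.ker dvg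

/-! ### Boundary traces -/

/-- The surface measure on `∂Ω` (up to a positive constant factor, which is immaterial here). -/
def surf (Ω : Set (Vec d)) : Measure (Vec d) := (μH[(d : ℝ) - 1]).restrict (frontier Ω)

/-- The boundary function `τ` is the trace of `v`: at almost every boundary point `x`, the mean of
`|v - τ(x)|` over `B(x,r) ∩ Ω` tends to zero as `r → 0`.  On a bounded Lipschitz domain every
function in `H¹(Ω)^d` has exactly one trace in this sense up to null sets, the usual one. -/
def IsTrace (v : H1 Ω) (τ : Vec d → Vec d) : Prop :=
  ∀ᵐ x ∂surf Ω, Tendsto (fun r : ℝ => ⨍ y in Metric.ball x r ∩ Ω, ‖fn v y - τ x‖)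
    (𝓝[>] 0) (𝓝 0)

/-- `tr(v) = tr(w)` on `∂Ω`. -/
def SameTrace (v w : H1 Ω) : Prop := ∃ τ, IsTrace v τ ∧ IsTrace w τ

/-- `n` is the outer unit normal of `Ω` at the boundary point `x`. -/
def IsOuterUnitNormal (Ω : Set (Vec d)) (x n : Vec d) : Prop :=
  ‖n‖ = 1 ∧ ∀ ε > 0, ∃ r > 0, ∀ y ∈ Metric.ball x r,
    (⟪n, y - x⟫ < -(ε * ‖y - x‖) → y ∈ Ω) ∧ (ε * ‖y - x‖ < ⟪n, y - x⟫ → y ∉ Ω)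

open Classical in
/-- The outer unit normal field (set to zero where it does not exist, a null set of the boundary of
a Lipschitz domain). -/
def outerNormal (Ω : Set (Vec d)) (x : Vec d) : Vec d :=
  if h : ∃ n, IsOuterUnitNormal Ω x n then h.choose else 0

/-- `H¹_∼(Ω)`, the functions `v ∈ H¹(Ω)^d` with `∫_{∂Ω} tr(v) · n = 0`. -/
def H1sim (Ω : Set (Vec d)) : Set (H1 Ω) :=
  {v | ∃ τ, IsTrace v τ ∧ Integrable (fun x => ⟪τ x, outerNormal Ω x⟫) (surf Ω) ∧
    ∫ x, ⟪τ x, outerNormal Ω x⟫ ∂surf Ω = 0}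

/-! ### The Stokes problem -/

/-- `(u, p)` is a weak solution of the Stokes problem with viscosity `ν`, right-hand side `f` and
Dirichlet boundary data `tr(g)`. -/
structure IsWeakStokesSolution (ν : ℝ) (f : Hneg1 Ω) (g u : H1 Ω) (p : L2 Ω ℝ) : Prop where
  velocity_mem : u ∈ H1sim Ω
  pressure_mem : p ∈ L20 Ω
  momentum : ∀ v : H10 Ω, ν * ⟪grad u, grad (v : H1 Ω)⟫ - ⟪p, dvg (v : H1 Ω)⟫ = f v
  incompressible : ∀ q ∈ L20 Ω, ⟪dvg u, q⟫ = 0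
  boundary : SameTrace u g

/-! ### Triangulations and the Scott–Vogelius spaces -/

/-- A conforming triangulation of `Ω̄` into finitely many nondegenerate closed `d`-simplices.  A
cell is given by its set of `d + 1` vertices; two cells meet in the simplex spanned by their common
vertices, or not at all. -/
structure Triangulation (Ω : Set (Vec d)) where
  cells : Finset (Finset (Vec d))
  card_eq : ∀ T ∈ cells, T.card = d + 1
  affineIndependent : ∀ T ∈ cells, AffineIndependent ℝ ((↑) : T → Vec d)
  conforming : ∀ S ∈ cells, ∀ T ∈ cells,
    convexHull ℝ (S : Set (Vec d)) ∩ convexHull ℝ (T : Set (Vec d))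
      ⊆ convexHull ℝ ((S : Set (Vec d)) ∩ T)
  covers : ⋃ T ∈ cells, convexHull ℝ (T : Set (Vec d)) = closure Ω

/-- The radius of the largest ball inscribed in `K`. -/
def inradius (K : Set (Vec d)) : ℝ := sSup {r : ℝ | 0 ≤ r ∧ ∃ c, Metric.closedBall c r ⊆ K}

/-- Shape regularity of a family of triangulations: `ρ_T ≥ χ h_T` uniformly for some `χ > 0`. -/
def ShapeRegular {ι : Type*} (𝒯 : ι → Triangulation Ω) : Prop :=
  ∃ χ > 0, ∀ h, ∀ T ∈ (𝒯 h).cells,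
    χ * Metric.diam (convexHull ℝ (T : Set (Vec d))) ≤ inradius (convexHull ℝ (T : Set (Vec d)))

/-- `w` is continuous on `Ω̄` and, on each cell, a vector of polynomials of degree at most `k`. -/
def IsContPiecewisePoly (𝒯 : Triangulation Ω) (k : ℕ) (w : Vec d → Vec d) : Prop :=
  ContinuousOn w (closure Ω) ∧ ∀ T ∈ 𝒯.cells, ∃ P : Fin d → MvPolynomial (Fin d) ℝ,
    (∀ i, (P i).totalDegree ≤ k) ∧
      ∀ x ∈ convexHull ℝ (T : Set (Vec d)), ∀ i, w x i = MvPolynomial.eval (fun j => x j) (P i)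

/-- The velocity space `X_h = 𝓛¹_k(𝒯)^d ⊆ H¹(Ω)^d` of continuous, piecewise polynomial fields. -/
def Xh (𝒯 : Triangulation Ω) (k : ℕ) : Submodule ℝ (H1 Ω) where
  carrier := {v | ∃ w, IsContPiecewisePoly 𝒯 k w ∧ fn v =ᵐ[volume.restrict Ω] w}
  zero_mem' := by
    refine ⟨0, ⟨continuousOn_const, fun T _ => ⟨0, by simp, by simp⟩⟩, ?_⟩
    rw [map_zero]
    exact Lp.coeFn_zero _ _ _
  add_mem' := by
    rintro v v' ⟨w, ⟨hc, hP⟩, hv⟩ ⟨w', ⟨hc', hP'⟩, hv'⟩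
    refine ⟨w + w', ⟨hc.add hc', fun T hT => ?_⟩, ?_⟩
    · obtain ⟨P, hd, hw⟩ := hP T hT
      obtain ⟨P', hd', hw'⟩ := hP' T hT
      refine ⟨P + P', fun i => ?_, fun x hx i => ?_⟩
      · exact (MvPolynomial.totalDegree_add _ _).trans (max_le (hd i) (hd' i))
      · simp [hw x hx i, hw' x hx i]
    · rw [map_add]
      exact (Lp.coeFn_add _ _).trans (hv.add hv')
  smul_mem' := by
    rintro c v ⟨w, ⟨hc, hP⟩, hv⟩
    refine ⟨c • w, ⟨hc.const_smul c, fun T hT => ?_⟩, ?_⟩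
    · obtain ⟨P, hd, hw⟩ := hP T hT
      refine ⟨c • P, fun i => ?_, fun x hx i => ?_⟩
      · exact (MvPolynomial.totalDegree_smul_le _ _).trans (hd i)
      · simp [hw x hx i, MvPolynomial.smul_eval]
    · rw [map_smul]
      exact (Lp.coeFn_smul _ _).trans (hv.const_smul c)

/-- `X_{h,∼} = X_h ∩ H¹_∼(Ω)`. -/
def Xsim (𝒯 : Triangulation Ω) (k : ℕ) : Set (H1 Ω) := (Xh 𝒯 k : Set (H1 Ω)) ∩ H1sim Ω

/-- `V_h = X_h ∩ H¹₀(Ω)^d`. -/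
def Vh (𝒯 : Triangulation Ω) (k : ℕ) : Submodule ℝ (H1 Ω) := Xh 𝒯 k ⊓ H10 Ω

/-- The pressure space `Q_h = div X_{h,∼}`. -/
def Qh (𝒯 : Triangulation Ω) (k : ℕ) : Set (L2 Ω ℝ) := dvg '' Xsim 𝒯 k

/-- Discrete inf-sup stability with constant `β`, uniformly over the family. -/
def InfSupStable {ι : Type*} (𝒯 : ι → Triangulation Ω) (k : ℕ) (β : ℝ) : Prop :=
  ∀ h, ∀ q ∈ Qh (𝒯 h) k,
    β * ‖q‖ ≤ ⨆ v : {v : H1 Ω // v ∈ Vh (𝒯 h) k ∧ v ≠ 0}, ⟪dvg v.1, q⟫ / ‖grad v.1‖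

/-- A trace preserving Fortin operator family with gradient stability constant `cF`. -/
structure IsFortin {ι : Type*} (𝒯 : ι → Triangulation Ω) (k : ℕ)
    (Pih : ∀ h, H1 Ω →ₗ[ℝ] Xh (𝒯 h) k) (cF : ℝ) : Prop where
  div_preserving : ∀ h (v : H1 Ω), ∀ q ∈ Qh (𝒯 h) k, ⟪dvg (Pih h v : H1 Ω), q⟫ = ⟪dvg v, q⟫
  stable : ∀ h (v : H1 Ω), ‖grad (Pih h v : H1 Ω)‖ ≤ cF * ‖grad v‖
  trace_discrete : ∀ h (v : H1 Ω), (∃ w ∈ Xh (𝒯 h) k, SameTrace v w) →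
    SameTrace (Pih h v : H1 Ω) v
  trace_mean : ∀ h, ∀ v ∈ H1sim Ω, (Pih h v : H1 Ω) ∈ Xsim (𝒯 h) k

/-- A trace preserving quasi-interpolation operator family with gradient stability constant
`cI`. -/
structure IsQuasiInterpolation {ι : Type*} (𝒯 : ι → Triangulation Ω) (k : ℕ)
    (Ih : ∀ h, H1 Ω →ₗ[ℝ] Xh (𝒯 h) k) (cI : ℝ) : Prop where
  trace_discrete : ∀ h (v : H1 Ω), (∃ w ∈ Xh (𝒯 h) k, SameTrace v w) →
    SameTrace (Ih h v : H1 Ω) v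
  trace_mean : ∀ h (v : H1 Ω), v - Ih h v ∈ H1sim Ω
  stable : ∀ h (v : H1 Ω), ‖grad (Ih h v : H1 Ω)‖ ≤ cI * ‖grad v‖

/-- The iterated penalty method with parameter `ρ`: starting from `φ_0 = 0`, for `i = 1, 2, …` the
iterate `u_i ∈ X_{h,∼}` with `tr(u_i) = tr(g_h)` solves the penalised problem with right-hand side
given by `φ_{i-1}`, and `φ_i = φ_{i-1} - ρ u_i`.  The entry `u_0` of the sequence plays no role. -/
structure IsIPM (𝒯 : Triangulation Ω) (k : ℕ) (ν ρ : ℝ) (f : Hneg1 Ω) (gh : H1 Ω)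
    (u φ : ℕ → H1 Ω) : Prop where
  init : φ 0 = 0
  mem : ∀ i, u (i + 1) ∈ Xsim 𝒯 k
  boundary : ∀ i, SameTrace (u (i + 1)) gh
  velocity : ∀ i, ∀ v (hv : v ∈ Vh 𝒯 k),
    ν * ⟪grad (u (i + 1)), grad v⟫ + ρ * ⟪dvg (u (i + 1)), dvg v⟫
      = f ⟨v, hv.2⟩ + ⟪dvg (φ i), dvg v⟫
  update : ∀ i, φ (i + 1) = φ i - ρ • u (i + 1)

end StokesIPM

end

open StokesIPM

/-! Let `w` be the Galerkin solution with exactly divergence-free velocity and the discrete boundary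
values, and `π` its pressure. Testing with divergence-free fields removes `p`, so `w` is a best
approximation in its class (`norm_galerkin_le`). The correction `v + Pih (u - v)` of any `v ∈ X_h`
lies in this class, which gives the factor `1 + cF`. The update of `φ` absorbs the penalty term: the
errors `uh i - w` and `dvg (φh i) - π` satisfy a homogeneous discrete momentum equation. Inf-sup
stability bounds the velocity error by its divergence, hence each step contracts it by `θ`
(`norm_penalty_step_le`). The first error is bounded by an energy estimate against `v + Ih (u - v)`,
which need not be divergence-free (`norm_first_iterate_sub_le`); there, and only there, the pressure
enters the velocity bound. The pressure estimate follows from inf-sup stability after projecting `p`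
onto `Q_h`. This algebra needs only linear maps between inner product spaces. To apply it,
differences of discrete functions with equal traces must lie in `V_h`
(`IsLipschitzDomain.mem_Vh_of_zeroTrace`). A zero trace forces vanishing on the boundary, because
relatively open pieces of the boundary have positive surface measure. Extension by zero is then
Lipschitz, and thresholding, mollification and weak compactness place the function in `H10`. Finite
dimensionality of `X_h` supplies the Galerkin solution. -/

namespace StokesIPM

/-! ### Iterated penalty in abstract inner product spaces. -/

section AbstractPenalty

variable {H G Q : Type*} [AddCommGroup H] [Module ℝ H]
  [NormedAddCommGroup G] [InnerProductSpace ℝ G] [NormedAddCommGroup Q] [InnerProductSpace ℝ Q]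
  {D : H →ₗ[ℝ] G} {B : H →ₗ[ℝ] Q} {V : Submodule ℝ H}

/-- Inf-sup stability of the pair `(V, B V)` with constant `β`, without suprema. -/
def AbstractInfSup (D : H →ₗ[ℝ] G) (B : H →ₗ[ℝ] Q) (V : Submodule ℝ H) (β : ℝ) : Prop :=
  ∀ q ∈ V.map B, ∀ C, 0 ≤ C → (∀ v ∈ V, ⟪B v, q⟫ ≤ C * ‖D v‖) → β * ‖q‖ ≤ C

/-- Existence of the Galerkin approximation of a Stokes problem in `w₀ + V`. -/
lemma exists_galerkin_stokes [FiniteDimensional ℝ V] (ν : ℝ) (u w₀ : H) (p : Q)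
    (hw₀ : B w₀ = 0) :
    ∃ w, w - w₀ ∈ V ∧ B w = 0 ∧ ∃ q ∈ V.map B, ∀ v ∈ V, ν * ⟪D (u - w), D v⟫ = ⟪p - q, B v⟫ := by
  let Z : Submodule ℝ H := V ⊓ LinearMap.ker B
  have : FiniteDimensional ℝ Z := Submodule.finiteDimensional_of_le inf_le_left
  -- The projection takes place in `G`, so `D` need not be injective or coercive on `Z`.
  let K : Submodule ℝ G := Z.map D
  obtain ⟨z, hz, hDz⟩ : K.starProjection (D (u - w₀)) ∈ Z.map D :=
    K.starProjection_apply_mem _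
  obtain ⟨hzV, hzB⟩ := Submodule.mem_inf.1 hz
  have horth : ∀ y ∈ Z, ⟪D (u - (w₀ + z)), D y⟫ = 0 := by
    intro y hy
    have := K.starProjection_inner_eq_zero (D (u - w₀)) (D y) (Submodule.mem_map_of_mem hy)
    rwa [← hDz, ← map_sub, sub_sub] at this
  have : FiniteDimensional ℝ (V.map B) := inferInstance
  let BV : V →ₗ[ℝ] V.map B := B.submoduleMap V
  -- The residual `ℓ` vanishes on the kernel of `BV`, so it factors through `V.map B`; Riesz
  -- representation there yields the pressure `q`.
  obtain ⟨s, hs⟩ := BV.exists_rightInverse_of_surjective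
    (LinearMap.range_eq_top.2 (B.submoduleMap_surjective V))
  let ℓ : V →ₗ[ℝ] ℝ := ((innerₗ Q p) ∘ₗ B - ν • ((innerₗ G (D (u - (w₀ + z)))) ∘ₗ D)) ∘ₗ V.subtype
  have hℓ : ∀ v : V, ℓ v = ⟪p, B v⟫ - ν * ⟪D (u - (w₀ + z)), D v⟫ := fun v => rfl
  have hker : ∀ v : V, BV v = 0 → ℓ v = 0 := by
    intro v hv
    have hv' : B v = 0 := congrArg Subtype.val hv
    rw [hℓ, hv', horth v ⟨v.2, hv'⟩]
    simp
  let q := (InnerProductSpace.toDual ℝ (V.map B)).symm (LinearMap.toContinuousLinearMap (ℓ ∘ₗ s))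
  refine ⟨w₀ + z, by simpa using hzV, by simp [hw₀, LinearMap.mem_ker.1 hzB], q, q.2, ?_⟩
  intro v hv
  have h1 : ⟪q, BV ⟨v, hv⟩⟫ = ℓ (s (BV ⟨v, hv⟩)) := by
    simp [q]
  have h2 : ℓ (⟨v, hv⟩ - s (BV ⟨v, hv⟩)) = 0 := by
    apply hker
    rw [map_sub, sub_eq_zero]
    exact (LinearMap.congr_fun hs (BV ⟨v, hv⟩)).symm
  rw [map_sub, sub_eq_zero, ← h1, hℓ] at h2
  have h3 : ⟪q, BV ⟨v, hv⟩⟫ = ⟪(q : Q), B v⟫ := rfl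
  rw [h3] at h2
  rw [inner_sub_left, ← h2]
  ring

/-- The test function `w - w₀` is in the kernel of `B`, so the pressures drop out and `D (u - w)` is
orthogonal to `D (w - w₀)`. -/
lemma norm_galerkin_le {ν : ℝ} (hν : 0 < ν) {u w w₀ : H} {p q : Q} (hw : w - w₀ ∈ V)
    (hBw : B w = 0) (hw₀ : B w₀ = 0) (h : ∀ v ∈ V, ν * ⟪D (u - w), D v⟫ = ⟪p - q, B v⟫) :
    ‖D (u - w)‖ ≤ ‖D (u - w₀)‖ := by
  have h1 := h _ hw
  rw [map_sub B, hBw, hw₀, sub_zero, inner_zero_right, mul_eq_zero] at h1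
  have h2 : ⟪D (u - w), D (w - w₀)⟫ = 0 := h1.resolve_left hν.ne'
  have h3 : ⟪D (u - w), D (u - w₀)⟫ = ‖D (u - w)‖ ^ 2 := by
    have : u - w₀ = (u - w) + (w - w₀) := by abel
    rw [this, map_add, inner_add_right, h2, add_zero, real_inner_self_eq_norm_sq]
  have h4 := real_inner_le_norm (D (u - w)) (D (u - w₀))
  rw [h3, sq] at h4
  rcases (norm_nonneg (D (u - w))).eq_or_lt with h0 | h0
  · rw [← h0]; positivity
  · exact le_of_mul_le_mul_left h4 h0

lemma AbstractInfSup.norm_le {β ν : ℝ} (hV : AbstractInfSup D B V β) (hν : 0 ≤ ν) {e : H} {r : Q}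
    (hr : r ∈ V.map B) (h : ∀ v ∈ V, ν * ⟪D e, D v⟫ = ⟪r, B v⟫) : β * ‖r‖ ≤ ν * ‖D e‖ := by
  refine hV r hr _ (by positivity) fun v hv => ?_
  rw [real_inner_comm, ← h v hv, mul_assoc]
  exact mul_le_mul_of_nonneg_left (real_inner_le_norm _ _) hν

/-- One step of the iterated penalty method contracts the velocity error. -/
lemma norm_penalty_step_le {β ν ρ : ℝ} (hβ : 0 < β) (hν : 0 < ν) (hρ : 0 < ρ)
    (hV : AbstractInfSup D B V β) {e e' : H} {r r' : Q} (he' : e' ∈ V) (hr' : r' ∈ V.map B)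
    (h : ∀ v ∈ V, ν * ⟪D e, D v⟫ = ⟪r, B v⟫) (h' : ∀ v ∈ V, ν * ⟪D e', D v⟫ = ⟪r', B v⟫)
    (hrr : r' = r - ρ • B e') :
    ‖D e'‖ ≤ ν / (ν + ρ * β ^ 2) * ‖D e‖ := by
  -- The momentum equation for `e'` stands in for orthogonality to the kernel of `B`: test it with
  -- `e'` and bound `r'` by inf-sup.
  have h1 : β * ‖D e'‖ ≤ ‖B e'‖ := by
    have a1 := hV.norm_le hν.le hr' h'
    have a2 := h' e' he'
    rw [real_inner_self_eq_norm_sq] at a2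
    have a3 := real_inner_le_norm r' (B e')
    rcases (norm_nonneg (D e')).eq_or_lt with h0 | h0
    · rw [← h0]; simp
    · refine le_of_mul_le_mul_left ?_ (mul_pos hν h0)
      calc ν * ‖D e'‖ * (β * ‖D e'‖) = β * (ν * ‖D e'‖ ^ 2) := by ring
        _ ≤ β * (‖r'‖ * ‖B e'‖) := by rw [a2]; gcongr
        _ = β * ‖r'‖ * ‖B e'‖ := by ring
        _ ≤ ν * ‖D e'‖ * ‖B e'‖ := by gcongr
  -- Both equations are tested with `e'`; the residuals differ by `ρ • B e'`.
  have h2 : ν * ‖D e'‖ ^ 2 + ρ * ‖B e'‖ ^ 2 = ν * ⟪D e, D e'⟫ := by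
    have a1 := h' e' he'
    rw [hrr, inner_sub_left, inner_smul_left, ← h e' he', real_inner_self_eq_norm_sq,
      real_inner_self_eq_norm_sq] at a1
    simp only [conj_trivial] at a1
    linarith
  have h3 : (ν + ρ * β ^ 2) * ‖D e'‖ ≤ ν * ‖D e‖ := by
    have a1 := real_inner_le_norm (D e) (D e')
    have a2 : (β * ‖D e'‖) ^ 2 ≤ ‖B e'‖ ^ 2 := by gcongr
    rcases (norm_nonneg (D e')).eq_or_lt with h0 | h0
    · rw [← h0]; simp; positivity
    · refine le_of_mul_le_mul_right ?_ h0
      nlinarith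
  rw [div_mul_eq_mul_div, le_div_iff₀ (by positivity)]
  linarith

/-- A priori bound for the first iterate of the penalty method. -/
lemma norm_first_iterate_sub_le {ν ρ : ℝ} (hν : 0 < ν) (hρ : 0 < ρ) {u u₁ s : H} {p : Q}
    (hs : u₁ - s ∈ V)
    (h : ∀ v ∈ V, ν * ⟪D u₁, D v⟫ + ρ * ⟪B u₁, B v⟫ = ν * ⟪D u, D v⟫ - ⟪p, B v⟫) :
    ‖D (u₁ - s)‖ ≤ ‖D (u - s)‖ + 1 / (2 * √(ρ * ν)) * ‖p + ρ • B s‖ := by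
  set x := ‖D (u₁ - s)‖
  set A := ‖D (u - s)‖
  set P := ‖p + ρ • B s‖
  set y := ‖B (u₁ - s)‖
  have h1 : ν * x ^ 2 + ρ * y ^ 2 = ν * ⟪D (u - s), D (u₁ - s)⟫ - ⟪p + ρ • B s, B (u₁ - s)⟫ := by
    have a1 := h _ hs
    rw [← real_inner_self_eq_norm_sq, ← real_inner_self_eq_norm_sq, map_sub D u s,
      inner_sub_left, inner_add_left, inner_smul_left, conj_trivial]
    nth_rewrite 1 [map_sub D u₁ s]
    nth_rewrite 1 [map_sub B u₁ s]
    rw [inner_sub_left, inner_sub_left]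
    linarith
  have h2 := real_inner_le_norm (D (u - s)) (D (u₁ - s))
  have h3 : -⟪p + ρ • B s, B (u₁ - s)⟫ ≤ P * y :=
    (neg_le_abs _).trans (abs_real_inner_le_norm _ _)
  have hx : 0 ≤ x := norm_nonneg _
  have hA : 0 ≤ A := norm_nonneg _
  have hP : 0 ≤ P := norm_nonneg _
  set m := √(ρ * ν)
  have hm : 0 < m := Real.sqrt_pos.2 (by positivity)
  have hm2 : m ^ 2 = ρ * ν := Real.sq_sqrt (by positivity)
  have h4 : ν * x ^ 2 + ρ * y ^ 2 ≤ ν * (A * x) + P * y := by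
    have := mul_le_mul_of_nonneg_left h2 hν.le
    linarith
  have h5 : x ^ 2 ≤ A * x + (1 / (2 * m) * P) ^ 2 := by
    have a1 : (1 / (2 * m) * P) ^ 2 = P ^ 2 / (4 * (ρ * ν)) := by
      rw [← hm2]; field_simp; ring
    rw [a1]
    -- Young's inequality spends the whole divergence term `ρ * y ^ 2`; this fixes the constant `1 /
    -- (2 * m)`.
    have a2 : P * y ≤ ρ * y ^ 2 + P ^ 2 / (4 * ρ) := by
      have : ρ * y ^ 2 + P ^ 2 / (4 * ρ) - P * y = (2 * ρ * y - P) ^ 2 / (4 * ρ) := by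
        field_simp; ring
      have : 0 ≤ (2 * ρ * y - P) ^ 2 / (4 * ρ) := by positivity
      linarith
    have a3 : P ^ 2 / (4 * (ρ * ν)) = P ^ 2 / (4 * ρ) / ν := by field_simp
    rw [a3]
    refine le_of_mul_le_mul_left ?_ hν
    rw [mul_add, mul_div_cancel₀ _ hν.ne']
    linarith
  have ht : 0 ≤ 1 / (2 * m) * P := by positivity
  -- If `x` exceeded `A + t` with `t = 1 / (2 * m) * P`, both `x` and `x - A` would exceed `t`,
  -- contradicting `x * (x - A) ≤ t ^ 2`.
  nlinarith

/-- Abstract error analysis of the iterated penalty method with iterates `U i` (starting with the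
first one) and pressures `Φ i` (starting with `Φ 0 = 0`): the errors are controlled by those of a
Galerkin approximation `w` and by the first error, which decays geometrically. -/
lemma exists_penalty_error_bounds [FiniteDimensional ℝ V] {β ν ρ : ℝ} (hβ : 0 < β) (hν : 0 < ν)
    (hρ : 0 < ρ) (hV : AbstractInfSup D B V β) {u : H} {p : Q} {U : ℕ → H} {Φ : ℕ → Q}
    (hU : ∀ i, U i - U 0 ∈ V) (hBU : ∀ i, B (U i) ∈ V.map B)
    (hΦ : Φ 0 = 0) (hΦU : ∀ i, Φ (i + 1) = Φ i - ρ • B (U i))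
    (h : ∀ i, ∀ v ∈ V, ν * ⟪D (U i), D v⟫ + ρ * ⟪B (U i), B v⟫
      = ν * ⟪D u, D v⟫ - ⟪p, B v⟫ + ⟪Φ i, B v⟫)
    {w₀ : H} (hw₀ : U 0 - w₀ ∈ V) (hBw₀ : B w₀ = 0) :
    ∃ a b : ℝ, 0 ≤ a ∧ 0 ≤ b ∧
      (∀ w, U 0 - w ∈ V → B w = 0 → a ≤ ‖D (u - w)‖) ∧
      (∀ s, U 0 - s ∈ V →
        b ≤ a + (2 * ‖D (u - s)‖ + 1 / (2 * √(ρ * ν)) * ‖p + ρ • B s‖)) ∧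
      (∀ i, ‖D (u - U i)‖ ≤ a + (ν / (ν + ρ * β ^ 2)) ^ i * b) ∧
      ∀ i, ∀ q ∈ V.map B, ‖p - Φ (i + 1)‖
        ≤ ‖p - q‖ + ν * β⁻¹ * (a + (ν / (ν + ρ * β ^ 2)) ^ i * b) := by
  obtain ⟨w, hw, hBw, π, hπ, hwπ⟩ := exists_galerkin_stokes (D := D) (V := V) ν u w₀ p hBw₀
  have hUw : ∀ i, U i - w ∈ V := fun i => by
    have := V.sub_mem (V.add_mem (hU i) hw₀) hw
    rwa [show U i - U 0 + (U 0 - w₀) - (w - w₀) = U i - w by abel] at this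
  have hΦmem : ∀ i, Φ i ∈ V.map B := by
    intro i
    induction i with
    | zero => rw [hΦ]; exact Submodule.zero_mem _
    | succ i ih => rw [hΦU]; exact Submodule.sub_mem _ ih (Submodule.smul_mem _ _ (hBU i))
  -- The updated pressure, with index `i + 1`, absorbs the penalty term of `U i`.
  have hmom : ∀ i, ∀ v ∈ V, ν * ⟪D (u - U i), D v⟫ = ⟪p - Φ (i + 1), B v⟫ := by
    intro i v hv
    have := h i v hv
    rw [hΦU, map_sub, inner_sub_left, inner_sub_left, inner_sub_left, inner_smul_left, conj_trivial]
    linarith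
  have herr : ∀ i, ∀ v ∈ V, ν * ⟪D (U i - w), D v⟫ = ⟪Φ (i + 1) - π, B v⟫ := by
    intro i v hv
    have h1 := hmom i v hv
    have h2 := hwπ v hv
    rw [map_sub, inner_sub_left, inner_sub_left] at h1 h2 ⊢
    linarith
  have hmem : ∀ i, Φ i - π ∈ V.map B := fun i => Submodule.sub_mem _ (hΦmem i) hπ
  set θ := ν / (ν + ρ * β ^ 2)
  have hθ : 0 ≤ θ := by positivity
  have hdecay : ∀ i, ‖D (U i - w)‖ ≤ θ ^ i * ‖D (U 0 - w)‖ := by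
    intro i
    induction i with
    | zero => simp
    | succ i ih =>
      refine (norm_penalty_step_le hβ hν hρ hV (hUw (i + 1)) (hmem (i + 2)) (herr i)
        (herr (i + 1)) ?_).trans ?_
      · rw [hΦU (i + 1), map_sub, hBw, sub_zero]; abel
      · rw [pow_succ' θ i, mul_assoc]
        exact mul_le_mul_of_nonneg_left ih hθ
  have hvel : ∀ i, ‖D (u - U i)‖ ≤ ‖D (u - w)‖ + θ ^ i * ‖D (U 0 - w)‖ := by
    intro i
    rw [show u - U i = (u - w) - (U i - w) by abel, map_sub]
    exact (norm_sub_le _ _).trans (add_le_add le_rfl (hdecay i))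
  refine ⟨‖D (u - w)‖, ‖D (U 0 - w)‖, norm_nonneg _, norm_nonneg _, ?_, ?_, hvel, ?_⟩
  · intro w' hw' hBw'
    refine norm_galerkin_le hν ?_ hBw hBw' hwπ
    have := V.sub_mem hw' (hUw 0)
    rwa [show U 0 - w' - (U 0 - w) = w - w' by abel] at this
  · intro s hs
    have h1 := norm_first_iterate_sub_le hν hρ (u := u) (p := p) hs fun v hv => by
      rw [h 0 v hv, hΦ, inner_zero_left, add_zero]
    have h2 : ‖D (U 0 - w)‖ ≤ ‖D (U 0 - s)‖ + ‖D (u - s)‖ + ‖D (u - w)‖ := by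
      rw [show U 0 - w = (U 0 - s) - (u - s) + (u - w) by abel, map_add, map_sub]
      exact (norm_add_le _ _).trans (add_le_add (norm_sub_le _ _) le_rfl)
    linarith
  · intro i q hq
    -- Since `p - r` is orthogonal to `V.map B`, the residual may be taken as `r - Φ (i + 1)`, to
    -- which inf-sup applies. The best approximation of `p` thus enters with factor one.
    let r : Q := (V.map B).starProjection p
    have hr : r ∈ V.map B := Submodule.starProjection_apply_mem _ _
    have h1 : ‖p - r‖ ≤ ‖p - q‖ := by
      rw [(V.map B).starProjection_minimal p]
      exact ciInf_le ⟨0, by rintro _ ⟨x, rfl⟩; exact norm_nonneg _⟩ (⟨q, hq⟩ : V.map B)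
    have h2 : β * ‖r - Φ (i + 1)‖ ≤ ν * ‖D (u - U i)‖ := by
      refine hV.norm_le hν.le (Submodule.sub_mem _ hr (hΦmem _)) fun v hv => ?_
      have h3 := (V.map B).starProjection_inner_eq_zero p (B v) (Submodule.mem_map_of_mem hv)
      rw [hmom i v hv, show p - Φ (i + 1) = (p - r) + (r - Φ (i + 1)) by abel, inner_add_left, h3,
        zero_add]
    have h3 : ‖r - Φ (i + 1)‖ ≤ ν * β⁻¹ * (‖D (u - w)‖ + θ ^ i * ‖D (U 0 - w)‖) := by
      have : ‖r - Φ (i + 1)‖ ≤ ν * β⁻¹ * ‖D (u - U i)‖ := by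
        rw [mul_right_comm, ← div_eq_mul_inv, le_div_iff₀ hβ]; linarith
      exact this.trans (mul_le_mul_of_nonneg_left (hvel i) (by positivity))
    rw [show p - Φ (i + 1) = (p - r) + (r - Φ (i + 1)) by abel]
    exact (norm_add_le _ _).trans (add_le_add h1 h3)

end AbstractPenalty
variable {d : ℕ} {Ω : Set (Vec d)}

/-! ### Calculus of traces -/

lemma volume_ball_inter_ne_top (x : Vec d) (r : ℝ) :
    volume (Metric.ball x r ∩ Ω) ≠ ⊤ :=
  ((measure_mono inter_subset_left).trans_lt Metric.isBounded_ball.measure_lt_top).ne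

lemma integrableOn_norm_fn_sub_const (v : H1 Ω) (a x : Vec d) (r : ℝ) :
    IntegrableOn (fun y => ‖fn v y - a‖) (Metric.ball x r ∩ Ω) := by
  have : IsFiniteMeasure (volume.restrict (Metric.ball x r ∩ Ω)) :=
    ⟨by simpa using (volume_ball_inter_ne_top x r).lt_top⟩
  have h : MemLp (fn v) 2 (volume.restrict (Metric.ball x r ∩ Ω)) :=
    (Lp.memLp (fn v)).mono_measure (Measure.restrict_mono inter_subset_right le_rfl)
  exact ((h.integrable (by norm_num)).sub (integrable_const a)).norm

lemma setAverage_norm_nonneg (f : Vec d → Vec d) (s : Set (Vec d)) : 0 ≤ ⨍ y in s, ‖f y‖ := by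
  rw [setAverage_eq]
  exact smul_nonneg (inv_nonneg.2 measureReal_nonneg) (integral_nonneg fun _ => norm_nonneg _)

lemma setAverage_le_add {f g h : Vec d → ℝ} {s : Set (Vec d)} (hf : IntegrableOn f s)
    (hg : IntegrableOn g s) (hh : IntegrableOn h s)
    (hle : ∀ᵐ y ∂volume.restrict s, h y ≤ f y + g y) :
    ⨍ y in s, h y ≤ (⨍ y in s, f y) + ⨍ y in s, g y := by
  simp only [setAverage_eq]
  rw [← smul_add, ← integral_add hf hg]
  exact smul_le_smul_of_nonneg_left (integral_mono_ae hh (hf.add hg) hle)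
    (inv_nonneg.2 measureReal_nonneg)

lemma fn_sub_ae (v w : H1 Ω) : fn (v - w) =ᵐ[volume.restrict Ω] fun y => fn v y - fn w y := by
  rw [map_sub]
  exact Lp.coeFn_sub _ _

lemma IsTrace.sub {v w : H1 Ω} {τ σ : Vec d → Vec d} (hv : IsTrace v τ) (hw : IsTrace w σ) :
    IsTrace (v - w) (fun x => τ x - σ x) := by
  filter_upwards [hv, hw] with x hvx hwx
  have hsum := hvx.add hwx
  rw [add_zero] at hsum
  refine squeeze_zero (fun r => setAverage_norm_nonneg _ _) (fun r => ?_) hsum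
  refine setAverage_le_add (integrableOn_norm_fn_sub_const v (τ x) x r)
    (integrableOn_norm_fn_sub_const w (σ x) x r) (integrableOn_norm_fn_sub_const _ _ x r) ?_
  filter_upwards [ae_restrict_of_ae_restrict_of_subset inter_subset_right (fn_sub_ae v w)] with y hy
  rw [hy, sub_sub_sub_comm]
  exact norm_sub_le _ _

lemma IsTrace.congr {v : H1 Ω} {τ σ : Vec d → Vec d} (h : IsTrace v τ) (hτ : ∀ x, τ x = σ x) :
    IsTrace v σ :=
  funext hτ ▸ h

lemma isTrace_of_continuousOn {v : H1 Ω} {w : Vec d → Vec d} (hw : ContinuousOn w (closure Ω))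
    (h : fn v =ᵐ[volume.restrict Ω] w) : IsTrace v w := by
  filter_upwards [ae_restrict_mem isClosed_frontier.measurableSet] with x hx
  rw [Metric.tendsto_nhds]
  intro ε hε
  obtain ⟨δ, hδ, hwδ⟩ := Metric.continuousWithinAt_iff.1 (hw x (frontier_subset_closure hx))
    (ε / 2) (half_pos hε)
  filter_upwards [Ioo_mem_nhdsGT hδ] with r hr
  rw [Real.dist_eq, sub_zero, abs_of_nonneg (setAverage_norm_nonneg _ _), setAverage_eq,
    smul_eq_mul]
  refine lt_of_le_of_lt ?_ (half_lt_self hε)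
  have h1 : ∫ y in Metric.ball x r ∩ Ω, ‖fn v y - w x‖
      ≤ ε / 2 * volume.real (Metric.ball x r ∩ Ω) := by
    refine (Real.le_norm_self _).trans
      (norm_setIntegral_le_of_norm_le_const_ae (volume_ball_inter_ne_top x r).lt_top ?_)
    have hball : ∀ᵐ y ∂volume.restrict (Metric.ball x r ∩ Ω), y ∈ Metric.ball x r :=
      ae_mono (Measure.restrict_mono inter_subset_left le_rfl)
        (ae_restrict_mem Metric.isOpen_ball.measurableSet)
    have hΩ : ∀ᵐ y ∂volume.restrict (Metric.ball x r ∩ Ω), y ∈ closure Ω :=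
      ae_mono (Measure.restrict_mono (inter_subset_right.trans subset_closure) le_rfl)
        (ae_restrict_mem isClosed_closure.measurableSet)
    filter_upwards [hball, hΩ, ae_restrict_of_ae_restrict_of_subset inter_subset_right h]
      with y hyr hyΩ hy
    rw [hy, norm_norm, ← dist_eq_norm]
    exact (hwδ hyΩ (lt_trans hyr hr.2)).le
  calc _ ≤ (volume.real (Metric.ball x r ∩ Ω))⁻¹ * (ε / 2 * volume.real (Metric.ball x r ∩ Ω)) := by
        gcongr
    _ = ε / 2 * ((volume.real (Metric.ball x r ∩ Ω))⁻¹ * volume.real (Metric.ball x r ∩ Ω)) := by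
        ring
    -- An inequality suffices and needs no positivity of the volume.
    _ ≤ ε / 2 := mul_le_of_le_one_right (half_pos hε).le inv_mul_le_one

lemma isTrace_zero : IsTrace (0 : H1 Ω) 0 := by
  refine isTrace_of_continuousOn continuousOn_const ?_
  rw [map_zero]
  exact Lp.coeFn_zero _ _ _

lemma IsTrace.neg_zero {v : H1 Ω} (hv : IsTrace v 0) : IsTrace (-v) 0 := by
  rw [← zero_sub v]
  exact (isTrace_zero.sub hv).congr fun x => by simp

/-- The functions in `H¹(Ω)^d` with vanishing trace. -/
def zeroTrace (Ω : Set (Vec d)) : AddSubgroup (H1 Ω) where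
  carrier := {v | IsTrace v 0}
  zero_mem' := isTrace_zero
  neg_mem' hv := IsTrace.neg_zero hv
  add_mem' {v w} hv hw := by
    rw [← sub_neg_eq_add v w]
    exact (IsTrace.sub hv (IsTrace.neg_zero hw)).congr fun x => by simp

/-- Chains of trace equalities become sums in a group, so neither transitivity of `SameTrace` nor a
general trace theorem is needed. -/
lemma SameTrace.sub_mem_zeroTrace {v w : H1 Ω} (h : SameTrace v w) : v - w ∈ zeroTrace Ω := by
  obtain ⟨τ, hv, hw⟩ := h
  exact (hv.sub hw).congr fun x => by simp

/-- By subtraction `τ` is a trace of the zero function. Its means are then the constant `‖τ x‖`,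
since balls around boundary points meet the open set `Ω` in positive volume. -/
lemma ae_eq_zero_of_isTrace_zero (hΩ : IsOpen Ω) {v : H1 Ω} {τ : Vec d → Vec d}
    (h : IsTrace v τ) (h0 : v ∈ zeroTrace Ω) : ∀ᵐ x ∂surf Ω, τ x = 0 := by
  have h1 : IsTrace v 0 := h0
  have h2 : IsTrace (0 : H1 Ω) τ := by
    have := h.sub h1
    simpa only [sub_self, Pi.zero_apply, sub_zero] using this
  filter_upwards [h2, ae_restrict_mem isClosed_frontier.measurableSet] with x hx hxΩ
  have h3 : ∀ r : ℝ, 0 < r → ⨍ y in Metric.ball x r ∩ Ω, ‖fn (0 : H1 Ω) y - τ x‖ = ‖τ x‖ := by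
    intro r hr
    have h4 : (fun y => ‖fn (0 : H1 Ω) y - τ x‖)
        =ᵐ[volume.restrict (Metric.ball x r ∩ Ω)] fun _ => ‖τ x‖ := by
      refine ae_restrict_of_ae_restrict_of_subset (s := Metric.ball x r ∩ Ω) inter_subset_right ?_
      rw [map_zero]
      filter_upwards [Lp.coeFn_zero (Vec d) 2 (volume.restrict Ω)] with y hy
      rw [hy, Pi.zero_apply, zero_sub, norm_neg]
    rw [average_congr h4]
    refine setAverage_const ?_ (volume_ball_inter_ne_top x r) _
    refine ((Metric.isOpen_ball.inter hΩ).measure_pos volume ?_).ne'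
    obtain ⟨y, hy, hxy⟩ := Metric.mem_closure_iff.1 (frontier_subset_closure hxΩ) r hr
    exact ⟨y, by rwa [Metric.mem_ball, dist_comm], hy⟩
  have h5 : Tendsto (fun _ : ℝ => ‖τ x‖) (𝓝[>] 0) (𝓝 0) := by
    refine hx.congr' ?_
    filter_upwards [self_mem_nhdsWithin] with r hr using h3 r hr
  exact norm_eq_zero.1 (tendsto_nhds_unique tendsto_const_nhds h5)

/-! ### Boundaries of Lipschitz domains -/

/-- Near `x` the boundary is a Lipschitz graph over the hyperplane orthogonal to `e`. Projection
onto this hyperplane does not increase Hausdorff measure, and the image contains a ball, on which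
that measure is a Haar measure. -/
lemma IsLipschitzDomain.hausdorffMeasure_frontier_pos (hΩ : IsLipschitzDomain Ω) {x : Vec d}
    (hx : x ∈ frontier Ω) {ε : ℝ} (hε : 0 < ε) :
    0 < μH[(d : ℝ) - 1] (frontier Ω ∩ Metric.ball x ε) := by
  obtain ⟨r, hr, e, he, γ, ⟨K, hK⟩, hγ, hΩr⟩ := hΩ.boundary x hx
  have he0 : e ≠ 0 := by rintro rfl; simp at he
  have hee : ⟪e, e⟫ = (1 : ℝ) := by rw [real_inner_self_eq_norm_sq, he]; norm_num
  have hball : ∀ y ∈ Metric.ball x r, γ y = ⟪e, y⟫ → y ∈ frontier Ω := by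
    intro y hy hye
    have hyΩ : y ∉ Ω := fun h => ((hΩr y hy).1 h).ne hye
    rw [frontier, hΩ.isOpen.interior_eq]
    refine ⟨?_, hyΩ⟩
    have hc : Tendsto (fun t : ℝ => y + t • e) (𝓝[>] 0) (𝓝 y) := by
      have : Continuous fun t : ℝ => y + t • e := by fun_prop
      simpa using (this.tendsto 0).mono_left nhdsWithin_le_nhds
    refine mem_closure_of_tendsto hc ?_
    filter_upwards [hc (Metric.isOpen_ball.mem_nhds hy), self_mem_nhdsWithin] with t ht ht0
    rw [hΩr _ ht, hγ, hye, inner_add_right, inner_smul_right, hee]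
    simpa using ht0
  have hxe : γ x = ⟪e, x⟫ := by
    have hxr := Metric.mem_ball_self (x := x) hr
    refine le_antisymm ?_ ?_
    · obtain ⟨s, hs, hsx⟩ := mem_closure_iff_seq_limit.1 (frontier_subset_closure hx)
      refine le_of_tendsto_of_tendsto ((hK.continuous.tendsto x).comp hsx)
        (((continuous_const.inner continuous_id).tendsto x).comp hsx) ?_
      filter_upwards [hsx (Metric.isOpen_ball.mem_nhds hxr)] with n hn
      exact ((hΩr _ hn).1 (hs n)).le
    · refine not_lt.1 fun h => ?_
      rw [frontier, hΩ.isOpen.interior_eq] at hx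
      exact hx.2 ((hΩr x hxr).2 h)
  let W : Submodule ℝ (Vec d) := (ℝ ∙ e)ᗮ
  have hW : (Module.finrank ℝ W : ℝ) = (d : ℝ) - 1 := by
    have := Submodule.finrank_add_finrank_orthogonal (ℝ ∙ e)
    rw [finrank_span_singleton he0, finrank_euclideanSpace_fin] at this
    have h' : (1 : ℝ) + Module.finrank ℝ W = d := by exact_mod_cast this
    linarith
  let π : Vec d → W := fun y => W.orthogonalProjectionOnto (y - x)
  have hπ : LipschitzWith 1 π := by
    refine LipschitzWith.of_dist_le_mul fun y y' => ?_
    simpa [π] using W.lipschitzWith_orthogonalProjectionOnto.dist_le_mul (y - x) (y' - x)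
  -- Lifting `z` to the graph adds a height of at most `K * ‖z‖`, so the lift stays within `(1 + K)
  -- * ‖z‖` of `x`.
  obtain ⟨δ, hδ, hδε⟩ : ∃ δ > 0, (1 + (K : ℝ)) * δ ≤ min r ε :=
    ⟨min r ε / (1 + K), by positivity, by rw [mul_div_cancel₀]; positivity⟩
  have himg : Metric.ball (0 : W) δ ⊆ π '' (frontier Ω ∩ Metric.ball x ε) := by
    intro z hz
    have hze : ⟪e, (z : Vec d)⟫ = 0 := Submodule.mem_orthogonal_singleton_iff_inner_right.1 z.2
    set t := γ (x + z) - ⟪e, x⟫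
    have ht : |t| ≤ K * ‖(z : Vec d)‖ := by
      have := hK.dist_le_mul (x + z) x
      rwa [Real.dist_eq, hxe, dist_eq_norm, add_sub_cancel_left] at this
    have hzδ : ‖(z : Vec d)‖ < δ := by simpa using hz
    have hdist : dist (x + z + t • e) x < min r ε := by
      rw [dist_eq_norm, add_assoc, add_sub_cancel_left]
      calc ‖(z : Vec d) + t • e‖ ≤ ‖(z : Vec d)‖ + |t| := by
            refine (norm_add_le _ _).trans ?_
            rw [norm_smul, he, mul_one, Real.norm_eq_abs]
        _ ≤ (1 + K) * ‖(z : Vec d)‖ := by linarith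
        _ < (1 + K) * δ := by gcongr
        _ ≤ _ := hδε
    refine ⟨x + z + t • e, ⟨hball _ (hdist.trans_le (min_le_left _ _)) ?_,
      hdist.trans_le (min_le_right _ _)⟩, ?_⟩
    · rw [hγ, inner_add_right, inner_add_right, inner_smul_right, hee, hze]
      ring
    · have h1 : W.orthogonalProjectionOnto (t • e) = 0 := by
        rw [map_smul, W.orthogonalProjectionOnto_apply_of_mem_orthogonal, smul_zero]
        exact Submodule.le_orthogonal_orthogonal _ (Submodule.mem_span_singleton_self e)
      simp only [π]
      rw [add_assoc, add_sub_cancel_left, map_add, h1, add_zero,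
        W.orthogonalProjectionOnto_mem_subspace_eq_self]
  have : (μH[(Module.finrank ℝ W : ℝ)] : Measure W).IsAddHaarMeasure :=
    isAddHaarMeasure_hausdorffMeasure
  have hpos : 0 < μH[(Module.finrank ℝ W : ℝ)] (Metric.ball (0 : W) δ) :=
    Metric.measure_ball_pos _ _ hδ
  have hle := hπ.hausdorffMeasure_image_le (d := (Module.finrank ℝ W : ℝ)) (by positivity)
    (frontier Ω ∩ Metric.ball x ε)
  rw [← hW]
  refine (hpos.trans_le (measure_mono himg)).trans_le (hle.trans ?_)
  simp

/-- A function that is continuous up to the boundary and has zero trace vanishes on the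
boundary. -/
lemma IsLipschitzDomain.eq_zero_on_frontier (hΩ : IsLipschitzDomain Ω) {v : H1 Ω}
    {w : Vec d → Vec d} (hw : ContinuousOn w (closure Ω)) (hv : fn v =ᵐ[volume.restrict Ω] w)
    (h0 : v ∈ zeroTrace Ω) : ∀ x ∈ frontier Ω, w x = 0 := by
  by_contra! ⟨x, hx, hwx⟩
  have hae := ae_eq_zero_of_isTrace_zero hΩ.isOpen (isTrace_of_continuousOn hw hv) h0
  have h1 : ∀ᶠ y in 𝓝[closure Ω] x, w y ≠ 0 :=
    (hw x (frontier_subset_closure hx)).eventually_ne hwx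
  obtain ⟨ε, hε, hε'⟩ := Metric.mem_nhdsWithin_iff.1 h1
  have h2 := hΩ.hausdorffMeasure_frontier_pos hx hε
  rw [surf, ae_restrict_iff' isClosed_frontier.measurableSet] at hae
  refine h2.ne' (measure_mono_null ?_ (ae_iff.1 hae))
  rintro y ⟨hy, hyε⟩ h
  exact hε' ⟨hyε, frontier_subset_closure hy⟩ (h hy)

/-! ### Approximation of Lipschitz functions by test functions -/

/-- Soft thresholding. -/
def softThreshold (η s : ℝ) : ℝ := max (s - η) 0 + min (s + η) 0

lemma abs_softThreshold_sub_le {η : ℝ} (hη : 0 ≤ η) (s t : ℝ) :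
    |softThreshold η s - softThreshold η t| ≤ |s - t| := by
  unfold softThreshold
  rcases le_total (s - η) 0 with h1 | h1 <;> rcases le_total (s + η) 0 with h2 | h2 <;>
  rcases le_total (t - η) 0 with h3 | h3 <;> rcases le_total (t + η) 0 with h4 | h4 <;>
  simp only [h1, h2, h3, h4, max_eq_left, max_eq_right, min_eq_left, min_eq_right] <;>
  rw [abs_le] <;> constructor <;>
  linarith [neg_abs_le (s - t), le_abs_self (s - t)]

lemma abs_softThreshold_sub_self_le {η : ℝ} (hη : 0 ≤ η) (s : ℝ) :
    |softThreshold η s - s| ≤ η := by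
  unfold softThreshold
  rcases le_total (s - η) 0 with h1 | h1 <;> rcases le_total (s + η) 0 with h2 | h2 <;>
  simp only [h1, h2, max_eq_left, max_eq_right, min_eq_left, min_eq_right] <;>
  rw [abs_le] <;> constructor <;> linarith

lemma le_abs_of_softThreshold_ne_zero {η s : ℝ} (h : softThreshold η s ≠ 0) :
    η ≤ |s| := by
  by_contra! hs
  rw [abs_lt] at hs
  apply h
  rw [softThreshold, max_eq_right (by linarith), min_eq_right (by linarith), add_zero]

/-- Soft thresholding confines the support to the compact set `η ≤ |f|` inside `Ω`, and
mollification smooths the result. Neither increases the Lipschitz constant, and each costs an error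
of at most `η`. -/
lemma exists_isTestFunction_approx (hΩ : IsOpen Ω) (hb : Bornology.IsBounded Ω) {f : Vec d → ℝ}
    {L : NNReal} (hf : LipschitzWith L f) (h0 : ∀ x ∉ Ω, f x = 0) {ε : ℝ} (hε : 0 < ε) :
    ∃ ψ, IsTestFunction Ω ψ ∧ (∀ x, |ψ x - f x| ≤ ε) ∧ LipschitzWith L ψ := by
  set η := ε / 2
  have hη : 0 < η := half_pos hε
  set F : Vec d → ℝ := fun x => softThreshold η (f x)
  have hF : LipschitzWith L F := LipschitzWith.of_dist_le_mul fun x y =>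
    (abs_softThreshold_sub_le hη.le _ _).trans (hf.dist_le_mul x y)
  set K : Set (Vec d) := {x | η ≤ |f x|}
  have hKΩ : K ⊆ Ω := fun x hx => by
    by_contra h
    have : η ≤ |f x| := hx
    rw [h0 x h, abs_zero] at this
    linarith
  have hKc : IsCompact K := Metric.isCompact_of_isClosed_isBounded
    (isClosed_le continuous_const hf.continuous.abs) (hb.subset hKΩ)
  have hFK : Function.support F ⊆ K := fun x hx => le_abs_of_softThreshold_ne_zero hx
  obtain ⟨δ, hδ, hδΩ⟩ := hKc.exists_cthickening_subset_open hΩ hKΩ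
  -- The bound `δ` keeps the support in `Ω`, the other one the mollification error below `η`; `L +
  -- 1` avoids division by zero.
  set r := min δ (η / (L + 1))
  have hr : 0 < r := by positivity
  let φ : ContDiffBump (0 : Vec d) := ⟨r / 2, r, half_pos hr, half_lt_self hr⟩
  let ψ : Vec d → ℝ := convolution (φ.normed volume) F (ContinuousLinearMap.lsmul ℝ ℝ) volume
  have hsupp : Function.support ψ ⊆ Metric.cthickening δ K := by
    refine (support_convolution_subset _).trans ?_
    rw [φ.support_normed_eq]
    rintro _ ⟨a, ha, b, hb, rfl⟩
    refine Metric.mem_cthickening_of_dist_le _ b _ _ (hFK hb) ?_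
    have : ‖a‖ < r := by simpa using ha
    rw [dist_eq_norm, add_sub_cancel_right]
    exact this.le.trans (min_le_left _ _)
  have htsupp : tsupport ψ ⊆ Metric.cthickening δ K :=
    closure_minimal hsupp Metric.isClosed_cthickening
  have hφc : Continuous (φ.normed volume) := φ.continuous_normed
  have hint : ∀ x, Integrable (fun t => φ.normed volume t * F (x - t)) := fun x =>
    (hφc.mul (hF.continuous.comp (by fun_prop))).integrable_of_hasCompactSupport
      φ.hasCompactSupport_normed.mul_right
  have hψ : ∀ x, ψ x = ∫ t, φ.normed volume t * F (x - t) := fun x => rfl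
  refine ⟨ψ, ⟨?_, ?_, htsupp.trans hδΩ⟩, ?_, ?_⟩
  · exact φ.hasCompactSupport_normed.contDiff_convolution_left _ φ.contDiff_normed
      hF.continuous.locallyIntegrable
  · exact hKc.cthickening.of_isClosed_subset (isClosed_tsupport _) htsupp
  · intro x
    have h1 : dist (ψ x) (F x) ≤ η := by
      refine φ.dist_normed_convolution_le hF.continuous.aestronglyMeasurable fun y hy => ?_
      refine (hF.dist_le_mul y x).trans ?_
      have hy' : dist y x ≤ η / (L + 1) := (le_of_lt hy).trans (min_le_right _ _)
      calc (L : ℝ) * dist y x ≤ (L + 1) * (η / (L + 1)) := by gcongr; simp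
        _ = η := by field_simp
    have h2 := abs_softThreshold_sub_self_le hη.le (f x)
    calc |ψ x - f x| ≤ |ψ x - F x| + |F x - f x| := abs_sub_le _ _ _
      _ ≤ η + η := add_le_add h1 h2
      _ = ε := add_halves ε
  · refine LipschitzWith.of_dist_le_mul fun x y => ?_
    rw [dist_eq_norm, hψ, hψ, ← integral_sub (hint x) (hint y)]
    calc ‖∫ t, (φ.normed volume t * F (x - t) - φ.normed volume t * F (y - t))‖
        ≤ ∫ t, φ.normed volume t * (L * dist x y) := by
          refine norm_integral_le_of_norm_le (φ.integrable_normed.mul_const _)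
            (Eventually.of_forall fun t => ?_)
          rw [← mul_sub, norm_mul, Real.norm_of_nonneg (φ.nonneg_normed t), ← dist_eq_norm]
          refine mul_le_mul_of_nonneg_left ?_ (φ.nonneg_normed t)
          simpa using hF.dist_le_mul (x - t) (y - t)
      _ = L * dist x y := by rw [integral_mul_const, φ.integral_normed, one_mul]

/-! ### Weak compactness -/

/-- Bounded sequences in Hilbert spaces have weak limits along a suitable filter. -/
lemma exists_weak_limit {E : Type*} [NormedAddCommGroup E] [InnerProductSpace ℝ E]
    [CompleteSpace E] {x : ℕ → E} {C : ℝ} (hx : ∀ n, ‖x n‖ ≤ C) :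
    ∃ (y : E) (l : Filter ℕ), l.NeBot ∧ l ≤ atTop ∧
      ∀ z, Tendsto (fun n => ⟪x n, z⟫) l (𝓝 ⟪y, z⟫) := by
  let T : ℕ → WeakDual ℝ E := fun n => StrongDual.toWeakDual (InnerProductSpace.toDual ℝ E (x n))
  have hT : ∀ n, T n ∈ WeakDual.toStrongDual ⁻¹' Metric.closedBall (0 : StrongDual ℝ E) C := by
    intro n
    rw [mem_preimage, mem_closedBall_zero_iff]
    exact ((InnerProductSpace.toDual ℝ E).norm_map (x n)).le.trans (hx n)
  -- Banach–Alaoglu along an ultrafilter replaces the extraction of a subsequence, so no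
  -- separability is required.
  obtain ⟨g, -, hg⟩ := (WeakDual.isCompact_closedBall (𝕜 := ℝ) (0 : StrongDual ℝ E)
    C).ultrafilter_le_nhds ((hyperfilter ℕ).map T) (by
      rw [le_principal_iff]
      exact Filter.mem_map.2 (univ_mem' hT))
  refine ⟨(InnerProductSpace.toDual ℝ E).symm (WeakDual.toStrongDual g), hyperfilter ℕ,
    inferInstance, Nat.hyperfilter_le_atTop, fun z => ?_⟩
  have h1 : Tendsto (fun n => T n z) (hyperfilter ℕ) (𝓝 (g z)) :=
    ((WeakDual.eval_continuous z).tendsto g).comp hg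
  simpa [T] using h1

/-! ### Test elements of `L²` -/

/-- The element `ψ e_k` of `L²`. -/
noncomputable def l2Single {κ : Type*} [Fintype κ] [DecidableEq κ] {ψ : Vec d → ℝ}
    (hψ : MemLp ψ 2 (volume.restrict Ω)) (k : κ) : L2 Ω (EuclideanSpace ℝ κ) :=
  ((ContinuousLinearMap.toSpanSingleton ℝ (EuclideanSpace.single k (1 : ℝ))).comp_memLp' hψ).toLp _

lemma inner_l2Single {κ : Type*} [Fintype κ] [DecidableEq κ] {ψ : Vec d → ℝ}
    (hψ : MemLp ψ 2 (volume.restrict Ω)) (k : κ) (w : L2 Ω (EuclideanSpace ℝ κ)) :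
    ⟪w, l2Single hψ k⟫ = ∫ x in Ω, w x k * ψ x := by
  rw [L2.inner_def]
  refine integral_congr_ae ?_
  filter_upwards [MemLp.coeFn_toLp ((ContinuousLinearMap.toSpanSingleton ℝ
    (EuclideanSpace.single k (1 : ℝ))).comp_memLp' hψ)] with x hx
  rw [l2Single, hx]
  have h1 : ⟪w x, EuclideanSpace.single k (1 : ℝ)⟫ = w x k := by
    rw [EuclideanSpace.inner_single_right]; simp
  simp [inner_smul_right, mul_comm, h1]

/-- As an orthogonality relation to fixed elements, being a weak gradient passes to weak limits. -/
lemma isWeakGradient_iff_inner_eq_zero (w : WithLp 2 (L2 Ω (Vec d) × L2 Ω (Mat d))) :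
    IsWeakGradient Ω w.fst w.snd ↔ ∀ (φ : Vec d → ℝ) (hφ : IsTestFunction Ω φ) (i j : Fin d),
      ⟪w, WithLp.toLp 2 (l2Single (hφ.memLp_partialDeriv j) i, l2Single hφ.memLp (i, j))⟫ = 0 := by
  refine forall_congr' fun φ => forall_congr' fun hφ => forall_congr' fun i =>
    forall_congr' fun j => ?_
  rw [WithLp.prod_inner_apply, inner_l2Single, inner_l2Single, eq_neg_iff_add_eq_zero]
  rfl

/-- The fundamental lemma of the calculus of variations in `L²(Ω)`. -/
lemma eq_zero_of_integral_test_eq_zero (hΩ : IsOpen Ω) (hb : Bornology.IsBounded Ω)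
    {κ : Type*} [Fintype κ] {w : L2 Ω (EuclideanSpace ℝ κ)}
    (h : ∀ (φ : Vec d → ℝ), IsTestFunction Ω φ → ∀ k, ∫ x in Ω, w x k * φ x = 0) : w = 0 := by
  have : IsFiniteMeasure (volume.restrict Ω) := ⟨by simpa using hb.measure_lt_top⟩
  rw [Lp.eq_zero_iff_ae_eq_zero]
  have hk : ∀ k, ∀ᵐ x ∂volume.restrict Ω, w x k = 0 := by
    intro k
    rw [ae_restrict_iff' hΩ.measurableSet]
    have hint : IntegrableOn (fun x => w x k) Ω := (memLp_coord w k).integrable (by norm_num)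
    refine hΩ.ae_eq_zero_of_integral_contDiff_smul_eq_zero hint.locallyIntegrableOn
      fun g hg hgc hgΩ => ?_
    rw [← h g ⟨hg, hgc, hgΩ⟩ k, setIntegral_eq_integral_of_forall_compl_eq_zero]
    · simp [mul_comm]
    · intro x hx
      rw [image_eq_zero_of_notMem_tsupport fun h => hx (hgΩ h), mul_zero]
  filter_upwards [ae_all_iff.2 hk] with x hx
  ext k
  exact hx k

lemma isWeakGradient_unique (hΩ : IsOpen Ω) (hb : Bornology.IsBounded Ω)
    {v w : WithLp 2 (L2 Ω (Vec d) × L2 Ω (Mat d))} (hv : v ∈ H1 Ω) (hw : w ∈ H1 Ω)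
    (h : v.fst = w.fst) : v = w := by
  have h1 : (v - w).fst = 0 := sub_eq_zero.2 h
  have h2 : (v - w).snd = 0 := by
    refine eq_zero_of_integral_test_eq_zero hΩ hb fun φ hφ k => ?_
    have h3 := (isWeakGradient_iff_inner_eq_zero (v - w)).1 ((H1 Ω).sub_mem hv hw) φ hφ k.1 k.2
    rw [WithLp.prod_inner_apply] at h3
    rw [← inner_l2Single hφ.memLp k]
    have h4 : ⟪(v - w).fst, l2Single (hφ.memLp_partialDeriv k.2) k.1⟫ = 0 := by
      rw [h1, inner_zero_left]
    exact (add_eq_right.2 h4).symm.trans h3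
  refine sub_eq_zero.1 ?_
  exact WithLp.ofLp_injective 2 (Prod.ext h1 h2)

/-! ### Test fields -/

lemma norm_euclidean_le {κ : Type*} [Fintype κ] {x : EuclideanSpace ℝ κ} {C : ℝ}
    (h : ∀ k, |x k| ≤ C) : ‖x‖ ≤ √(Fintype.card κ * C ^ 2) := by
  rw [EuclideanSpace.norm_eq]
  refine Real.sqrt_le_sqrt ?_
  calc ∑ k, ‖x k‖ ^ 2 ≤ ∑ _k : κ, C ^ 2 := by
        refine Finset.sum_le_sum fun k _ => ?_
        have := h k
        rw [Real.norm_eq_abs]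
        gcongr
    _ = _ := by simp

lemma IsTestFunction.integral_mul_partialDeriv {φ χ : Vec d → ℝ} (hφ : IsTestFunction Ω φ)
    (hχ : IsTestFunction Ω χ) (j : Fin d) :
    ∫ x in Ω, φ x * partialDeriv j χ x = - ∫ x in Ω, partialDeriv j φ x * χ x := by
  have hz : ∀ {ψ : Vec d → ℝ}, IsTestFunction Ω ψ → ∀ x ∉ Ω, ψ x = 0 := fun hψ x hx =>
    image_eq_zero_of_notMem_tsupport fun h => hx (hψ.2.2 h)
  rw [setIntegral_eq_integral_of_forall_compl_eq_zero fun x hx => by rw [hz hφ x hx, zero_mul],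
    setIntegral_eq_integral_of_forall_compl_eq_zero fun x hx => by rw [hz hχ x hx, mul_zero]]
  have hc : ∀ {ψ : Vec d → ℝ}, IsTestFunction Ω ψ → Continuous (partialDeriv j ψ) := fun hψ =>
    (hψ.1.continuous_fderiv (by simp)).clm_apply continuous_const
  have hd : ∀ {ψ : Vec d → ℝ}, IsTestFunction Ω ψ → Differentiable ℝ ψ := fun hψ =>
    hψ.1.differentiable (by simp)
  refine integral_mul_fderiv_eq_neg_fderiv_mul_of_integrable
    (((hc hφ).mul hχ.1.continuous).integrable_of_hasCompactSupport hχ.2.1.mul_left)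
    ((hφ.1.continuous.mul (hc hχ)).integrable_of_hasCompactSupport hφ.2.1.mul_right)
    ((hφ.1.continuous.mul hχ.1.continuous).integrable_of_hasCompactSupport hφ.2.1.mul_right)
    (fun x _ => hd hφ x) (fun x _ => hd hχ x)

lemma norm_L2_le_of_ae_bound {F : Type*} [NormedAddCommGroup F] (hb : Bornology.IsBounded Ω)
    {f : L2 Ω F} {C : ℝ} (hC : 0 ≤ C) (h : ∀ᵐ x ∂volume.restrict Ω, ‖f x‖ ≤ C) :
    ‖f‖ ≤ volume.real Ω ^ (2⁻¹ : ℝ) * C := by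
  have : IsFiniteMeasure (volume.restrict Ω) := ⟨by simpa using hb.measure_lt_top⟩
  refine (Lp.norm_le_of_ae_bound hC h).trans_eq ?_
  simp [measureUnivNNReal, measureReal_def, ENNReal.coe_toNNReal_eq_toReal]

/-- The gradient bound depends on `ψ` only through `L`, so approximants with a common Lipschitz
constant are bounded in `H1`. -/
lemma exists_testField (hb : Bornology.IsBounded Ω) {ψ : Fin d → Vec d → ℝ}
    (hψ : ∀ i, IsTestFunction Ω (ψ i)) {L : NNReal} (hL : ∀ i, LipschitzWith L (ψ i)) :
    ∃ v ∈ testFields Ω, (fn v =ᵐ[volume.restrict Ω] fun x => WithLp.toLp 2 fun i => ψ i x) ∧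
      ‖grad v‖ ≤ volume.real Ω ^ (2⁻¹ : ℝ) * √(Fintype.card (Fin d × Fin d) * (L : ℝ) ^ 2) := by
  have : IsFiniteMeasure (volume.restrict Ω) := ⟨by simpa using hb.measure_lt_top⟩
  have h1 : MemLp (fun x => WithLp.toLp 2 fun i => ψ i x) 2 (volume.restrict Ω) :=
    MemLp.of_eval_piLp fun i => (hψ i).memLp
  have h2 : MemLp (fun x => (WithLp.toLp 2 fun k : Fin d × Fin d => partialDeriv k.2 (ψ k.1) x))
      2 (volume.restrict Ω) :=
    MemLp.of_eval_piLp fun k => (hψ k.1).memLp_partialDeriv k.2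
  have hH1 : (WithLp.toLp 2 (h1.toLp _, h2.toLp _) : WithLp 2 (L2 Ω (Vec d) × L2 Ω (Mat d)))
      ∈ H1 Ω := by
    intro φ hφ i j
    refine Eq.trans (integral_congr_ae ?_) (((hψ i).integral_mul_partialDeriv hφ j).trans
      (congrArg Neg.neg (integral_congr_ae ?_)))
    · filter_upwards [h1.coeFn_toLp] with x hx
      simp [hx]
    · filter_upwards [h2.coeFn_toLp] with x hx
      simp [hx]
  refine ⟨⟨_, hH1⟩, ⟨_, fun i => hψ i, h1.coeFn_toLp⟩, h1.coeFn_toLp, ?_⟩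
  have h3 : ∀ᵐ x ∂volume.restrict Ω, ‖h2.toLp _ x‖
      ≤ √(Fintype.card (Fin d × Fin d) * (L : ℝ) ^ 2) := by
    filter_upwards [h2.coeFn_toLp] with x hx
    rw [hx]
    refine norm_euclidean_le fun k => ?_
    have h4 := (fderiv ℝ (ψ k.1) x).le_opNorm (EuclideanSpace.single k.2 1)
    have h5 := norm_fderiv_le_of_lipschitz ℝ (hL k.1) (x₀ := x)
    rw [PiLp.norm_single, norm_one, mul_one] at h4
    exact h4.trans h5
  exact norm_L2_le_of_ae_bound hb (by positivity) h3

/-- A function in `H¹(Ω)^d` whose extension by zero is Lipschitz belongs to `H¹₀(Ω)^d`. -/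
lemma mem_H10_of_lipschitz (hΩ : IsOpen Ω) (hb : Bornology.IsBounded Ω) {v : H1 Ω}
    {W : Vec d → Vec d} (hv : fn v =ᵐ[volume.restrict Ω] W) (h0 : ∀ x ∉ Ω, W x = 0)
    {L : NNReal} (hW : ∀ i, LipschitzWith L fun x => W x i) : v ∈ H10 Ω := by
  choose ψ hψ hψW hψL using fun (n : ℕ) (i : Fin d) => exists_isTestFunction_approx hΩ hb (hW i)
    (fun x hx => by rw [h0 x hx]; rfl) (Nat.one_div_pos_of_nat (α := ℝ) (n := n))
  choose w hw hwψ hwL using fun n => exists_testField hb (hψ n) (hψL n)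
  have hdist : ∀ n, ‖fn (w n) - fn v‖ ≤
      volume.real Ω ^ (2⁻¹ : ℝ) * √(Fintype.card (Fin d) * (1 / ((n : ℝ) + 1)) ^ 2) := by
    intro n
    refine norm_L2_le_of_ae_bound hb (by positivity) ?_
    filter_upwards [Lp.coeFn_sub (fn (w n)) (fn v), hwψ n, hv] with x h1 h2 h3
    rw [h1, Pi.sub_apply, h2, h3]
    exact norm_euclidean_le fun i => hψW n i x
  have hlim : Tendsto (fun n => fn (w n)) atTop (𝓝 (fn v)) := by
    rw [tendsto_iff_norm_sub_tendsto_zero]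
    refine squeeze_zero (fun n => norm_nonneg _) hdist ?_
    have h1 : Tendsto (fun n : ℕ => 1 / ((n : ℝ) + 1)) atTop (𝓝 0) :=
      tendsto_one_div_add_atTop_nhds_zero_nat
    have h2 := (((h1.pow 2).const_mul (Fintype.card (Fin d) : ℝ)).sqrt).const_mul
      (volume.real Ω ^ (2⁻¹ : ℝ))
    simpa using h2
  obtain ⟨M, hM⟩ := hlim.norm.bddAbove_range
  -- The functions converge strongly, the gradients are merely bounded; hence a weak limit `y` of
  -- the pairs, identified with `v` by uniqueness of weak gradients.
  obtain ⟨y, l, hl, hlt, hy⟩ := exists_weak_limit (x := fun n => (w n).1)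
    (C := M + volume.real Ω ^ (2⁻¹ : ℝ) * √(Fintype.card (Fin d × Fin d) * (L : ℝ) ^ 2)) (by
      intro n
      have h1 : ‖(w n).1.fst‖ ≤ M := hM ⟨n, rfl⟩
      have h2 : ‖(w n).1.snd‖ ≤ _ := hwL n
      refine le_trans ?_ (add_le_add h1 h2)
      rw [WithLp.prod_norm_eq_of_L2]
      refine Real.sqrt_le_iff.2 ⟨by positivity, ?_⟩
      nlinarith [norm_nonneg (w n).1.fst, norm_nonneg (w n).1.snd])
  let K : Submodule ℝ (WithLp 2 (L2 Ω (Vec d) × L2 Ω (Mat d))) :=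
    (testFields Ω).map (H1 Ω).subtype
  -- The closure is the double orthogonal complement, which is weakly closed.
  have hyK : y ∈ K.topologicalClosure := by
    rw [← K.orthogonal_orthogonal_eq_closure, Submodule.mem_orthogonal']
    intro z hz
    refine tendsto_nhds_unique (hy z) (tendsto_const_nhds.congr fun n => ?_)
    exact (hz _ (Submodule.mem_map_of_mem (hw n))).symm
  have hyH1 : y ∈ H1 Ω := by
    refine (isWeakGradient_iff_inner_eq_zero y).2 fun φ hφ i j => ?_
    refine tendsto_nhds_unique (hy _) (tendsto_const_nhds.congr fun n => ?_)
    exact ((isWeakGradient_iff_inner_eq_zero _).1 (w n).2 φ hφ i j).symm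
  have hyv : y.fst = v.1.fst := by
    refine ext_inner_right ℝ fun z => ?_
    have h1 := hy (WithLp.toLp 2 (z, 0))
    simp only [WithLp.prod_inner_apply, inner_zero_right, add_zero] at h1
    exact tendsto_nhds_unique h1 ((hlim.mono_left hlt).inner tendsto_const_nhds)
  have hyv' := isWeakGradient_unique hΩ hb hyH1 v.2 hyv
  rw [hyv'] at hyK
  exact closure_subtype.2 hyK

/-! ### Piecewise Lipschitz functions -/

/-- Jump from `a` to the last point `t` of a set containing `a`; that set is not needed beyond `t`,
so induction on the number of sets applies. -/
lemma abs_sub_le_of_closed_cover {ι : Type*} {A : ι → Set ℝ} (hA : ∀ j, IsClosed (A j)) {g : ℝ → ℝ}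
    {L : ℝ} (hg : ∀ j, ∀ x ∈ A j, ∀ y ∈ A j, |g x - g y| ≤ L * |x - y|) (s : Finset ι) {a b : ℝ}
    (hab : a ≤ b) (hs : Icc a b ⊆ ⋃ j ∈ s, A j) : |g b - g a| ≤ L * (b - a) := by
  classical
  induction s using Finset.strongInduction generalizing a with
  | H s ih =>
    obtain ⟨j, hjs, haj⟩ := mem_iUnion₂.1 (hs (left_mem_Icc.2 hab))
    have hS : IsCompact (A j ∩ Icc a b) := isCompact_Icc.inter_left (hA j)
    obtain ⟨t, ⟨htj, hat, htb⟩, hmax⟩ := hS.exists_isGreatest ⟨a, haj, left_mem_Icc.2 hab⟩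
    have h1 : |g t - g a| ≤ L * (t - a) := by
      simpa [abs_of_nonneg (sub_nonneg.2 hat)] using hg j t htj a haj
    rcases htb.eq_or_lt with rfl | htb'
    · exact h1
    have hcov : Icc t b ⊆ ⋃ i ∈ s.erase j, A i := by
      -- The remaining sets cover the interval without `t`; their finite union is closed and so
      -- contains `t` as well.
      rw [← closure_Ioc htb'.ne]
      refine closure_minimal (fun y hy => ?_) (isClosed_biUnion_finset fun i _ => hA i)
      have hya : y ∈ Icc a b := ⟨hat.trans hy.1.le, hy.2⟩
      obtain ⟨i, hi, hyi⟩ := mem_iUnion₂.1 (hs hya)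
      refine mem_iUnion₂.2 ⟨i, Finset.mem_erase.2 ⟨?_, hi⟩, hyi⟩
      rintro rfl
      exact (hmax ⟨hyi, hya⟩).not_gt hy.1
    have h2 := ih _ (Finset.erase_ssubset hjs) htb hcov
    calc |g b - g a| ≤ |g b - g t| + |g t - g a| := abs_sub_le _ _ _
      _ ≤ L * (b - t) + L * (t - a) := add_le_add h2 h1
      _ = L * (b - a) := by ring

/-- A function which is Lipschitz on each set of a finite closed cover of a normed space is
Lipschitz. -/
lemma lipschitzWith_of_closed_cover {E ι : Type*} [NormedAddCommGroup E] [NormedSpace ℝ E]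
    [Fintype ι] {A : ι → Set E} (hA : ∀ j, IsClosed (A j)) (hcov : ⋃ j, A j = univ) {f : E → ℝ}
    {L : NNReal} (hf : ∀ j, LipschitzOnWith L f (A j)) : LipschitzWith L f := by
  refine LipschitzWith.of_dist_le_mul fun y x => ?_
  let c : ℝ → E := fun t => x + t • (y - x)
  have hc : Continuous c := by fun_prop
  -- Restriction to the segment from `x` to `y`, parametrised on the unit interval, multiplies the
  -- Lipschitz constant by `dist y x`.
  have h := abs_sub_le_of_closed_cover (A := fun j => c ⁻¹' A j) (g := fun t => f (c t))
    (L := L * dist y x) (fun j => (hA j).preimage hc) (fun j s hs t ht => by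
      have h1 := (hf j).dist_le_mul _ hs _ ht
      have h2 : dist (c s) (c t) = |s - t| * dist y x := by
        rw [dist_eq_norm, dist_eq_norm, ← Real.norm_eq_abs, ← norm_smul]
        congr 1
        simp only [c]
        module
      rw [h2] at h1
      calc |f (c s) - f (c t)| ≤ L * (|s - t| * dist y x) := h1
        _ = _ := by ring) Finset.univ zero_le_one (fun t _ => by
      have : c t ∈ ⋃ j, A j := hcov ▸ mem_univ _
      simpa using this)
  simpa [c, Real.dist_eq] using h

lemma contDiff_eval_mvPolynomial (P : MvPolynomial (Fin d) ℝ) :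
    ContDiff ℝ 1 fun x : Vec d => MvPolynomial.eval (fun j => x j) P := by
  induction P using MvPolynomial.induction_on with
  | C a => simpa using contDiff_const
  | add p q hp hq => simpa using hp.add hq
  | mul_X p i hp =>
    have : ContDiff ℝ 1 fun x : Vec d => x i :=
      (EuclideanSpace.proj (𝕜 := ℝ) i : Vec d →L[ℝ] ℝ).contDiff
    simpa using hp.mul this

lemma Triangulation.convexHull_subset (𝒯 : Triangulation Ω) {T : Finset (Vec d)}
    (hT : T ∈ 𝒯.cells) : convexHull ℝ (T : Set (Vec d)) ⊆ closure Ω := by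
  rw [← 𝒯.covers]
  exact subset_biUnion_of_mem (u := fun T : Finset (Vec d) => convexHull ℝ (T : Set (Vec d))) hT

/-- A continuous piecewise polynomial that vanishes on the boundary has a Lipschitz extension
by zero. -/
lemma IsContPiecewisePoly.exists_lipschitzWith_indicator (hΩ : IsOpen Ω) {𝒯 : Triangulation Ω}
    {k : ℕ} {w : Vec d → Vec d} (hw : IsContPiecewisePoly 𝒯 k w)
    (h0 : ∀ x ∈ frontier Ω, w x = 0) :
    ∃ L : NNReal, ∀ i, LipschitzWith L fun x => Ω.indicator w x i := by
  have hcl : ∀ x ∈ closure Ω, Ω.indicator w x = w x := by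
    intro x hx
    by_cases hxΩ : x ∈ Ω
    · exact indicator_of_mem hxΩ _
    · rw [indicator_of_notMem hxΩ, h0 x]
      rw [frontier, hΩ.interior_eq]
      exact ⟨hx, hxΩ⟩
  have hcell : ∀ (T : 𝒯.cells) (i : Fin d), ∃ L : NNReal,
      LipschitzOnWith L (fun x => Ω.indicator w x i) (convexHull ℝ (T.1 : Set (Vec d))) := by
    intro T i
    obtain ⟨P, -, hP⟩ := hw.2 T.1 T.2
    obtain ⟨L, hL⟩ := (contDiff_eval_mvPolynomial (P i)).contDiffOn.exists_lipschitzOnWith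
      one_ne_zero (convex_convexHull ℝ (T.1 : Set (Vec d)))
      (T.1.finite_toSet.isCompact_convexHull ℝ)
    refine ⟨L, fun x hx y hy => ?_⟩
    simp only [hcl _ (𝒯.convexHull_subset T.2 hx), hcl _ (𝒯.convexHull_subset T.2 hy), hP x hx i,
      hP y hy i]
    exact hL hx hy
  choose L hL using hcell
  refine ⟨∑ T, ∑ i, L T i, fun i => ?_⟩
  -- The index `none` stands for the complement of `Ω`, where the extension vanishes.
  refine lipschitzWith_of_closed_cover (ι := Option 𝒯.cells)
    (A := fun j => j.elim Ωᶜ fun T => convexHull ℝ (T.1 : Set (Vec d))) ?_ ?_ ?_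
  · rintro (_ | T)
    · exact hΩ.isClosed_compl
    · exact (T.1.finite_toSet.isCompact_convexHull ℝ).isClosed
  · rw [eq_univ_iff_forall]
    intro x
    by_cases hx : x ∈ Ω
    · have h1 := subset_closure hx
      rw [← 𝒯.covers] at h1
      obtain ⟨T, hT, hxT⟩ := mem_iUnion₂.1 h1
      exact mem_iUnion.2 ⟨some ⟨T, hT⟩, hxT⟩
    · exact mem_iUnion.2 ⟨none, hx⟩
  · rintro (_ | T)
    · intro x hx y hy
      simp only [indicator_of_notMem (show x ∉ Ω from hx),
        indicator_of_notMem (show y ∉ Ω from hy), edist_self, zero_le]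
    · refine (hL T i).weaken ?_
      exact (Finset.single_le_sum (f := fun i => L T i) (fun _ _ => zero_le)
        (Finset.mem_univ i)).trans
        (Finset.single_le_sum (f := fun T => ∑ i, L T i) (fun _ _ => zero_le)
          (Finset.mem_univ T))

/-- Finite element functions with zero trace belong to `H¹₀(Ω)^d`. -/
lemma IsLipschitzDomain.mem_Vh_of_zeroTrace (hΩ : IsLipschitzDomain Ω) {𝒯 : Triangulation Ω} {k : ℕ}
    {v : H1 Ω} (hv : v ∈ Xh 𝒯 k) (h0 : v ∈ zeroTrace Ω) : v ∈ Vh 𝒯 k := by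
  refine ⟨hv, ?_⟩
  obtain ⟨w, hw, hvw⟩ := hv
  obtain ⟨L, hL⟩ := hw.exists_lipschitzWith_indicator hΩ.isOpen
    (hΩ.eq_zero_on_frontier hw.1 hvw h0)
  refine mem_H10_of_lipschitz hΩ.isOpen hΩ.isBounded ?_ (fun x hx => indicator_of_notMem hx w) hL
  filter_upwards [hvw, ae_restrict_mem hΩ.isOpen.measurableSet] with x hx hxΩ
  rw [hx, indicator_of_mem hxΩ]

/-! ### Finite dimensionality -/

/-- The relation between the coefficients of a piecewise polynomial and the function. -/
def coeffRel (𝒯 : Triangulation Ω) (k : ℕ) :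
    Submodule ℝ ((𝒯.cells → Fin d → MvPolynomial.restrictTotalDegree (Fin d) ℝ k) × H1 Ω) where
  carrier := {z | ∀ᵐ x ∂volume.restrict Ω, ∀ T : 𝒯.cells, x ∈ convexHull ℝ (T.1 : Set (Vec d)) →
    ∀ i, fn z.2 x i = MvPolynomial.eval (fun j => x j) (z.1 T i).1}
  zero_mem' := by
    filter_upwards [Lp.coeFn_zero (Vec d) 2 (volume.restrict Ω)] with x hx T _ i
    simp only [Prod.snd_zero, map_zero, hx]
    simp
  add_mem' {z z'} hz hz' := by
    filter_upwards [hz, hz', Lp.coeFn_add (fn z.2) (fn z'.2)] with x h h' hx T hT i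
    simp only [Prod.snd_add, map_add, hx]
    simp [h T hT i, h' T hT i]
  smul_mem' c z hz := by
    filter_upwards [hz, Lp.coeFn_smul c (fn z.2)] with x h hx T hT i
    simp only [Prod.smul_snd, map_smul, hx]
    simp [h T hT i, MvPolynomial.smul_eval]

lemma fn_injective (hΩ : IsOpen Ω) (hb : Bornology.IsBounded Ω) :
    Function.Injective (fn : H1 Ω →ₗ[ℝ] L2 Ω (Vec d)) := fun v w h =>
  Subtype.ext (isWeakGradient_unique hΩ hb v.2 w.2 h)

lemma eq_zero_of_coeffRel (hΩ : IsOpen Ω) (hb : Bornology.IsBounded Ω) {𝒯 : Triangulation Ω}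
    {k : ℕ} {v : H1 Ω} (h : (0, v) ∈ coeffRel 𝒯 k) : v = 0 := by
  apply fn_injective hΩ hb
  rw [map_zero, Lp.eq_zero_iff_ae_eq_zero]
  filter_upwards [mem_ofPred.1 h, ae_restrict_mem hΩ.measurableSet] with x hx hxΩ
  have h1 := subset_closure hxΩ
  rw [← 𝒯.covers] at h1
  obtain ⟨T, hT, hxT⟩ := mem_iUnion₂.1 h1
  ext i
  simpa using hx ⟨T, hT⟩ hxT i

/-- Since the cells cover `Ω`, coefficients determine the function, so `coeffRel` embeds into the
coefficient space. It projects onto a space containing `X_h`, and no linear choice of coefficients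
is needed. -/
lemma finiteDimensional_Xh (hΩ : IsOpen Ω) (hb : Bornology.IsBounded Ω) (𝒯 : Triangulation Ω)
    (k : ℕ) : FiniteDimensional ℝ (Xh 𝒯 k) := by
  let F : coeffRel 𝒯 k →ₗ[ℝ] (𝒯.cells → Fin d → MvPolynomial.restrictTotalDegree (Fin d) ℝ k) :=
    LinearMap.fst ℝ _ _ ∘ₗ (coeffRel 𝒯 k).subtype
  have hinj : Function.Injective F := by
    rw [injective_iff_map_eq_zero]
    intro z hz
    have h1 : z.1.1 = 0 := hz
    refine Subtype.ext (Prod.ext h1 ?_)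
    have h2 : (z.1.1, z.1.2) ∈ coeffRel 𝒯 k := z.2
    rw [h1] at h2
    exact eq_zero_of_coeffRel hΩ hb h2
  have : FiniteDimensional ℝ (coeffRel 𝒯 k) := FiniteDimensional.of_injective F hinj
  have hle : Xh 𝒯 k ≤ (coeffRel 𝒯 k).map (LinearMap.snd ℝ _ _) := by
    rintro v ⟨w, ⟨-, hP⟩, hv⟩
    choose P hdeg hP using hP
    refine ⟨⟨fun T i => ⟨P T.1 T.2 i, (MvPolynomial.mem_restrictTotalDegree _ _ _).2
      (hdeg T.1 T.2 i)⟩, v⟩, ?_, rfl⟩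
    filter_upwards [hv] with x hx T hT i
    rw [hx]
    exact hP T.1 T.2 x hT i
  exact Submodule.finiteDimensional_of_le hle

/-! ### Constants and corrected candidates in the abstract estimate. -/

lemma sqrt_mul_div_two_mul_sqrt {ν ρ : ℝ} (hν : 0 < ν) (hρ : 0 < ρ) (d : ℕ) :
    1 / (2 * √(ρ * ν)) * (ρ * √d) = √((d : ℝ) / 2) * √(ρ / (2 * ν)) := by
  rw [Real.sqrt_div (Nat.cast_nonneg d), Real.sqrt_div hρ.le, Real.sqrt_mul two_pos.le,
    Real.sqrt_mul hρ.le]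
  have h1 := Real.sqrt_pos.2 hρ
  have h2 := Real.sqrt_pos.2 hν
  have h3 : √(2 : ℝ) * √2 = 2 := Real.mul_self_sqrt two_pos.le
  have h4 : √ρ * √ρ = ρ := Real.mul_self_sqrt hρ.le
  calc 1 / (2 * (√ρ * √ν)) * (ρ * √d) = (√ρ * √ρ) * √d / (√2 * √2 * (√ρ * √ν)) := by
        rw [h3, h4]; ring
    _ = √d / √2 * (√ρ / (√2 * √ν)) := by field_simp

lemma one_div_two_mul_sqrt_le {ν ρ : ℝ} (hν : 0 < ν) (hρ : 0 < ρ) :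
    1 / (2 * √(ρ * ν)) ≤ 1 / √(2 * ρ * ν) := by
  refine one_div_le_one_div_of_le (Real.sqrt_pos.2 (by positivity)) ?_
  rw [show (2 : ℝ) * √(ρ * ν) = √(2 ^ 2 * (ρ * ν)) by
    rw [Real.sqrt_mul (sq_nonneg _), Real.sqrt_sq two_pos.le]]
  refine Real.sqrt_le_sqrt ?_
  have := mul_pos hρ hν
  nlinarith

lemma map_mem_of_sub_mem {H Q : Type*} [AddCommGroup H] [Module ℝ H] [AddCommGroup Q]
    [Module ℝ Q] {B : H →ₗ[ℝ] Q} {V : Submodule ℝ H} {y w : H} (hy : B y ∈ V.map B)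
    (h : y - w ∈ V) : B w ∈ V.map B := by
  rw [← sub_sub_cancel y w, map_sub]
  exact Submodule.sub_mem _ hy (Submodule.mem_map_of_mem h)

lemma norm_map_sub_add_le {H G : Type*} [AddCommGroup H] [Module ℝ H] [NormedAddCommGroup G]
    [NormedSpace ℝ G] {D : H →ₗ[ℝ] G} {u v z : H} {c : ℝ} (h : ‖D z‖ ≤ c * ‖D (u - v)‖) :
    ‖D (u - (v + z))‖ ≤ (1 + c) * ‖D u - D v‖ := by
  rw [← sub_sub, map_sub, ← map_sub D u v, add_mul, one_mul]
  exact (norm_sub_le _ _).trans (add_le_add le_rfl h)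

lemma norm_add_smul_map_add_le {H Q : Type*} [AddCommGroup H] [Module ℝ H] [NormedAddCommGroup Q]
    [NormedSpace ℝ Q] {B : H →ₗ[ℝ] Q} {v z : H} {p : Q} {ρ c : ℝ} (hρ : 0 ≤ ρ)
    (h : ‖B z‖ ≤ c) : ‖p + ρ • B (v + z)‖ ≤ ‖p + ρ • B v‖ + ρ * c := by
  rw [map_add, smul_add, ← add_assoc]
  refine (norm_add_le _ _).trans (add_le_add le_rfl ?_)
  rw [norm_smul, Real.norm_of_nonneg hρ]
  gcongr

/-- Tested against itself, `B (v + z)` acts like `B v + B (u - v) = B u`, which is zero. -/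
lemma map_correction_eq_zero {H Q : Type*} [AddCommGroup H] [Module ℝ H] [NormedAddCommGroup Q]
    [InnerProductSpace ℝ Q] {B : H →ₗ[ℝ] Q} {u v z : H} (hu : B u = 0)
    (h : ⟪B z, B (v + z)⟫ = ⟪B (u - v), B (v + z)⟫) : B (v + z) = 0 := by
  rw [← inner_self_eq_zero (𝕜 := ℝ)]
  nth_rewrite 1 [map_add]
  rw [inner_add_left, h, map_sub, hu, zero_sub, inner_neg_left, add_neg_cancel]

section AbstractPenalty

variable {H G Q : Type*} [AddCommGroup H] [Module ℝ H]
  [NormedAddCommGroup G] [InnerProductSpace ℝ G] [NormedAddCommGroup Q] [InnerProductSpace ℝ Q]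
  {D : H →ₗ[ℝ] G} {B : H →ₗ[ℝ] Q} {V X : Submodule ℝ H}

/-- The a priori error estimate of the iterated penalty method in an abstract setting, with
operators `P` and `I` that produce candidates for the discrete boundary values. -/
theorem penalty_apriori_estimate [FiniteDimensional ℝ V] {β ν ρ cF cI θ c₁ c₂ : ℝ} {d : ℕ}
    (hβ : 0 < β) (hν : 0 < ν) (hρ : 0 < ρ) (hcF : 0 < cF) (hcI : 0 < cI)
    (hθ : θ = ν / (ν + ρ * β ^ 2))
    (hc₁ : c₁ = 2 * (1 + cI) + √((d : ℝ) / 2) * √(ρ / (2 * ν)) * cI)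
    (hc₂ : c₂ = 1 / √(2 * ρ * ν))
    (hV : AbstractInfSup D B V β) (hBD : ∀ v, ‖B v‖ ≤ √d * ‖D v‖)
    {u : H} {p : Q} {uh φh : ℕ → H} {S : Set Q} (hS : ∀ q ∈ S, q ∈ V.map B)
    (hBU : ∀ i, B (uh (i + 1)) ∈ S) (hU : ∀ i, uh (i + 1) - uh 1 ∈ V)
    (hφ0 : φh 0 = 0) (hφ : ∀ i, φh (i + 1) = φh i - ρ • uh (i + 1))
    (hvar : ∀ i, ∀ v ∈ V, ν * ⟪D (uh (i + 1)), D v⟫ + ρ * ⟪B (uh (i + 1)), B v⟫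
      = ν * ⟪D u, D v⟫ - ⟪p, B v⟫ + ⟪B (φh i), B v⟫)
    {P I : H → H} (hP : ∀ v, ‖D (P v)‖ ≤ cF * ‖D v‖) (hI : ∀ v, ‖D (I v)‖ ≤ cI * ‖D v‖)
    (hw : ∀ v ∈ X, uh 1 - (v + P (u - v)) ∈ V) (hBw : ∀ v ∈ X, B (v + P (u - v)) = 0)
    (hs : ∀ v ∈ X, uh 1 - (v + I (u - v)) ∈ V) :
    (∀ i : ℕ, 1 ≤ i →
      ‖D u - D (uh i)‖ ≤
        2 * (1 + cF) *
            (⨅ v : X,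
              ‖D u - D (v : H)‖)
          + θ ^ (i - 1) *
            (⨅ v : X,
              (c₁ * ‖D u - D (v : H)‖
                + c₂ * ‖p + ρ • B (v : H)‖))) ∧
    (∀ i : ℕ, 1 ≤ i →
      ‖p - B (φh i)‖ ≤
        2 * ν * (1 + cF) * β⁻¹ *
            (⨅ v : X,
              ‖D u - D (v : H)‖)
          + (⨅ q : S, ‖p - (q : Q)‖)
          + (ν + ρ * β) / β * θ ^ (i - 1) *
            (⨅ v : X,
              (c₁ * ‖D u - D (v : H)‖
                + c₂ * ‖p + ρ • B (v : H)‖))) ∧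
    Filter.Tendsto (fun i : ℕ => θ ^ (i - 1) *
        (⨅ v : X,
          (c₁ * ‖D u - D (v : H)‖
            + c₂ * ‖p + ρ • B (v : H)‖)))
      Filter.atTop (nhds 0) := by
  have hS0 : B (uh 1) ∈ S := hBU 0
  obtain ⟨a, b, ha, hb, haw, hbs, hvel, hpres⟩ := exists_penalty_error_bounds
    (U := fun i => uh (i + 1)) (Φ := fun i => B (φh i)) hβ hν hρ hV hU (fun i => hS _ (hBU i))
    (by simp [hφ0]) (fun i => by simp [hφ i]) hvar
    -- The choice `v = 0` gives `P u` as a divergence-free field with the discrete boundary values.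
    (hw 0 (Submodule.zero_mem _)) (hBw 0 (Submodule.zero_mem _))
  rw [← hθ] at hvel hpres
  have hθ0 : 0 ≤ θ := by rw [hθ]; positivity
  have hθ1 : θ < 1 := by
    rw [hθ, div_lt_one (by positivity)]
    have : 0 < ρ * β ^ 2 := by positivity
    linarith
  set E := ⨅ v : X, ‖D u - D (v : H)‖
  set J := ⨅ v : X, (c₁ * ‖D u - D (v : H)‖ + c₂ * ‖p + ρ • B (v : H)‖)
  have hE : 0 ≤ E := Real.iInf_nonneg fun _ => norm_nonneg _
  have hc₁0 : 0 ≤ c₁ := by rw [hc₁]; positivity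
  have hc₂0 : 0 ≤ c₂ := by rw [hc₂]; positivity
  have hJ : 0 ≤ J := Real.iInf_nonneg fun _ => by positivity
  have haE : a ≤ (1 + cF) * E := by
    rw [Real.mul_iInf_of_nonneg (by positivity)]
    exact le_ciInf fun v => (haw _ (hw v v.2) (hBw v v.2)).trans
      (norm_map_sub_add_le (hP _))
  have hbJ : b ≤ a + J := by
    rw [← sub_le_iff_le_add']
    refine le_ciInf fun v => sub_le_iff_le_add'.2 ((hbs _ (hs v v.2)).trans ?_)
    have h1 := norm_map_sub_add_le (hI (u - v))
    have h2 := norm_add_smul_map_add_le (v := (v : H)) (p := p) hρ.le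
      ((hBD (I (u - v))).trans
        (mul_le_mul_of_nonneg_left (hI (u - v)) (Real.sqrt_nonneg _)))
    rw [map_sub D u] at h2
    have h3 := sqrt_mul_div_two_mul_sqrt hν hρ d
    have h4 := one_div_two_mul_sqrt_le hν hρ
    rw [← hc₂] at h4
    set t := 1 / (2 * √(ρ * ν))
    have ht : 0 ≤ t := by positivity
    set N := ‖D u - D (v : H)‖
    set M := ‖p + ρ • B (v : H)‖
    -- The divergence of the correction moves a multiple of `N` from the pressure term into `c₁`; `t
    -- ≤ c₂` leaves a factor `√2` to spare.
    calc _ ≤ a + (2 * ((1 + cI) * N) + t * (M + ρ * (√d * (cI * N)))) := by gcongr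
      _ = a + ((2 * (1 + cI) + t * (ρ * √d) * cI) * N + t * M) := by ring
      _ ≤ a + (c₁ * N + c₂ * M) := by
        rw [h3, ← hc₁]
        gcongr
  -- The Galerkin error occurs once directly and once inside `b`; hence the factor two.
  have hmain : ∀ i : ℕ, a + θ ^ i * b ≤ 2 * (1 + cF) * E + θ ^ i * J := by
    intro i
    have h1 : θ ^ i ≤ 1 := pow_le_one₀ hθ0 hθ1.le
    have h2 : θ ^ i * b ≤ θ ^ i * (a + J) := by gcongr
    have h3 : θ ^ i * a ≤ a := mul_le_of_le_one_left ha h1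
    linarith
  refine ⟨fun i hi => ?_, fun i hi => ?_, ?_⟩
  · obtain ⟨j, rfl⟩ := Nat.exists_eq_add_of_le' hi
    rw [← map_sub]
    exact (hvel j).trans (hmain j)
  · obtain ⟨j, rfl⟩ := Nat.exists_eq_add_of_le' hi
    rw [Nat.add_sub_cancel]
    have hne : Nonempty S := ⟨⟨_, hS0⟩⟩
    have h1 : ‖p - B (φh (j + 1))‖ - ν * β⁻¹ * (a + θ ^ j * b)
        ≤ ⨅ q : S, ‖p - (q : Q)‖ := by
      refine le_ciInf fun q => sub_le_iff_le_add.2 (hpres j q (hS q q.2))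
    have h2 : ν * β⁻¹ * (a + θ ^ j * b) ≤ ν * β⁻¹ * (2 * (1 + cF) * E + θ ^ j * J) := by
      exact mul_le_mul_of_nonneg_left (hmain j) (by positivity)
    -- The estimate already holds with `ν / β` in place of `(ν + ρ * β) / β`; the summand with `ρ`
    -- is discarded as nonnegative.
    have h3 : (ν + ρ * β) / β * θ ^ j * J = ν * β⁻¹ * (θ ^ j * J) + ρ * (θ ^ j * J) := by
      field_simp
    have h4 : 0 ≤ ρ * (θ ^ j * J) := by positivity
    rw [h3]
    linarith
  · have h1 := (tendsto_pow_atTop_nhds_zero_of_lt_one hθ0 hθ1).comp (tendsto_sub_atTop_nat 1)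
    simpa using h1.mul_const J

end AbstractPenalty

/-! ### The Scott–Vogelius discretisation -/

/-- Cauchy–Schwarz over the `d` diagonal entries; this is the source of `d` in `c₁`. -/
lemma norm_dvg_le (v : H1 Ω) : ‖dvg v‖ ≤ √d * ‖grad v‖ := by
  have h : ‖(matTrace : Mat d →L[ℝ] ℝ)‖ ≤ √d := by
    refine ContinuousLinearMap.opNorm_le_bound _ (Real.sqrt_nonneg _) fun A => ?_
    have h1 : matTrace A = ∑ i, A (i, i) := by simp [matTrace]
    rw [h1, EuclideanSpace.norm_eq, ← Real.sqrt_mul (Nat.cast_nonneg _), Real.norm_eq_abs]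
    refine Real.abs_le_sqrt ?_
    calc (∑ i, A (i, i)) ^ 2 ≤ d * ∑ i, A (i, i) ^ 2 := by
          simpa using sq_sum_le_card_mul_sum_sq (s := Finset.univ) (f := fun i => A (i, i))
      _ ≤ d * ∑ k, ‖A k‖ ^ 2 := by
          gcongr
          rw [Fintype.sum_prod_type]
          refine Finset.sum_le_sum fun i _ => ?_
          rw [← sq_abs, ← Real.norm_eq_abs]
          exact Finset.single_le_sum (f := fun j => ‖A (i, j)‖ ^ 2)
            (fun j _ => by positivity) (Finset.mem_univ i)
  refine ((matTrace.compLpL 2 (volume.restrict Ω)).le_opNorm (grad v)).trans ?_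
  exact mul_le_mul_of_nonneg_right ((ContinuousLinearMap.norm_compLpL_le _).trans h)
    (norm_nonneg _)

lemma sameTrace_self_of_mem_Xh {𝒯 : Triangulation Ω} {k : ℕ} {v : H1 Ω} (hv : v ∈ Xh 𝒯 k) :
    SameTrace v v := by
  obtain ⟨w, hw, hvw⟩ := hv
  exact ⟨w, isTrace_of_continuousOn hw.1 hvw, isTrace_of_continuousOn hw.1 hvw⟩

/-- If `P` preserves discrete traces and `u` has the boundary values approximated by `P g`, then
`v + P (u - v)` has the discrete boundary values for every `v ∈ X_h`. -/
lemma IsLipschitzDomain.sub_correction_mem_Vh (hΩ : IsLipschitzDomain Ω) {𝒯 : Triangulation Ω}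
    {k : ℕ} {P : H1 Ω →ₗ[ℝ] Xh 𝒯 k}
    (hP : ∀ v, (∃ w ∈ Xh 𝒯 k, SameTrace v w) → SameTrace (P v : H1 Ω) v)
    {u g gh y : H1 Ω} (hug : SameTrace u g) (hgh : SameTrace gh (P g : H1 Ω))
    (hy : y ∈ Xh 𝒯 k) (hygh : SameTrace y gh) {v : H1 Ω} (hv : v ∈ Xh 𝒯 k) :
    y - (v + P (u - v)) ∈ Vh 𝒯 k := by
  refine hΩ.mem_Vh_of_zeroTrace (Submodule.sub_mem _ hy (Submodule.add_mem _ hv (P _).2)) ?_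
  -- Neither `u` nor `g` need have a discrete trace, but `u - g` has the trace of `0 ∈ X_h`, so `P`
  -- preserves its trace.
  have h1 : SameTrace (u - g) 0 := ⟨0, hug.sub_mem_zeroTrace, isTrace_zero⟩
  have h2 := (hP _ ⟨0, Submodule.zero_mem _, h1⟩).sub_mem_zeroTrace
  have h3 := (hP v ⟨v, hv, sameTrace_self_of_mem_Xh hv⟩).sub_mem_zeroTrace
  have h4 := AddSubgroup.add_mem _ (AddSubgroup.sub_mem _
    (AddSubgroup.add_mem _ hygh.sub_mem_zeroTrace hgh.sub_mem_zeroTrace)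
    (AddSubgroup.add_mem _ h2 hug.sub_mem_zeroTrace)) h3
  convert h4 using 1
  simp only [map_sub, Submodule.coe_sub]
  abel

lemma SameTrace.sub_mem_zeroTrace_of_sameTrace {v w z : H1 Ω} (hv : SameTrace v z)
    (hw : SameTrace w z) : v - w ∈ zeroTrace Ω := by
  rw [← sub_sub_sub_cancel_right v w z]
  exact AddSubgroup.sub_mem _ hv.sub_mem_zeroTrace hw.sub_mem_zeroTrace

section Discrete

variable {ι : Type*} {𝒯 : ι → Triangulation Ω} {k : ℕ} {h : ι}

lemma Qh_eq_map (hdiv : dvg '' (Vh (𝒯 h) k : Set (H1 Ω)) = dvg '' Xsim (𝒯 h) k) :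
    Qh (𝒯 h) k = ((Vh (𝒯 h) k).map dvg : Submodule ℝ (L2 Ω ℝ)) := by
  rw [Submodule.map_coe, hdiv]
  rfl

lemma mem_Qh_iff (hdiv : dvg '' (Vh (𝒯 h) k : Set (H1 Ω)) = dvg '' Xsim (𝒯 h) k) {q : L2 Ω ℝ} :
    q ∈ Qh (𝒯 h) k ↔ q ∈ (Vh (𝒯 h) k).map dvg := by
  rw [Qh_eq_map hdiv, SetLike.mem_coe]

lemma dvg_mem_Qh {y : H1 Ω} (hy : y ∈ Xsim (𝒯 h) k) : dvg y ∈ Qh (𝒯 h) k := ⟨y, hy, rfl⟩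

lemma InfSupStable.abstractInfSup {β : ℝ} (hinfsup : InfSupStable 𝒯 k β)
    (hdiv : dvg '' (Vh (𝒯 h) k : Set (H1 Ω)) = dvg '' Xsim (𝒯 h) k) :
    AbstractInfSup grad dvg (Vh (𝒯 h) k) β := by
  intro q hq C hC hle
  -- Nonnegativity of `C` covers an empty index set and quotients with zero denominator, both of
  -- value zero.
  refine (hinfsup h q ((mem_Qh_iff hdiv).2 hq)).trans (Real.iSup_le (fun v => ?_) hC)
  exact div_le_of_le_mul₀ (norm_nonneg _) hC (hle v.1 v.2.1)

/-- The correction of `v ∈ X_h` by the Fortin operator is divergence-free. -/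
lemma IsFortin.dvg_correction_eq_zero {Pih : ∀ h, H1 Ω →ₗ[ℝ] Xh (𝒯 h) k} {cF : ℝ}
    (hPi : IsFortin 𝒯 k Pih cF)
    (hdiv : dvg '' (Vh (𝒯 h) k : Set (H1 Ω)) = dvg '' Xsim (𝒯 h) k)
    {u y : H1 Ω} (hu : u ∈ H1div Ω) (hy : y ∈ Xsim (𝒯 h) k) {v : H1 Ω}
    (hyv : y - (v + Pih h (u - v)) ∈ Vh (𝒯 h) k) :
    dvg (v + Pih h (u - v) : H1 Ω) = 0 := by
  -- The divergence differs from that of `y` by an element of `div V_h`, so it is an admissible test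
  -- function for the Fortin property.
  have hw : dvg (v + Pih h (u - v) : H1 Ω) ∈ Qh (𝒯 h) k :=
    (mem_Qh_iff hdiv).2 (map_mem_of_sub_mem ((mem_Qh_iff hdiv).1 (dvg_mem_Qh hy)) hyv)
  exact map_correction_eq_zero (LinearMap.mem_ker.1 hu) (hPi.div_preserving h (u - v) _ hw)

end Discrete

end StokesIPM

open StokesIPM
theorem mainTheorem1 {d : ℕ} (hd : 2 ≤ d) (Ω : Set (Vec d))
    (hΩ : IsLipschitzDomain Ω)
    (ν : ℝ) (hν : 0 < ν) (f : Hneg1 Ω)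
    (g : H1 Ω) (hg : g ∈ H1sim Ω)
    (u : H1 Ω) (p : L2 Ω ℝ) (hu : u ∈ H1div Ω)
    (hup : IsWeakStokesSolution ν f g u p)
    {ι : Type*} (𝒯 : ι → Triangulation Ω) (h𝒯 : ShapeRegular 𝒯) (k : ℕ)
    (β : ℝ) (hβ : 0 < β) (hinfsup : InfSupStable 𝒯 k β)
    (hdiv : ∀ h, dvg '' (Vh (𝒯 h) k : Set (H1 Ω))
      = dvg '' Xsim (𝒯 h) k)
    (Pih : ∀ h, H1 Ω →ₗ[ℝ] Xh (𝒯 h) k) (cF : ℝ) (hcF : 0 < cF)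
    (hPi : IsFortin 𝒯 k Pih cF)
    (Ih : ∀ h, H1 Ω →ₗ[ℝ] Xh (𝒯 h) k) (cI : ℝ) (hcI : 0 < cI)
    (hI : IsQuasiInterpolation 𝒯 k Ih cI)
    (ρ : ℝ) (hρ : 0 < ρ) (θ c₁ c₂ : ℝ)
    (hθ : θ = ν / (ν + ρ * β ^ 2))
    (hc₁ : c₁ = 2 * (1 + cI) + √((d : ℝ) / 2) * √(ρ / (2 * ν)) * cI)
    (hc₂ : c₂ = 1 / √(2 * ρ * ν))
    (h : ι) (gh : H1 Ω) (hgh : gh ∈ Xh (𝒯 h) k)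
    (hghI : SameTrace gh (Ih h g : H1 Ω))
    (hghPi : SameTrace gh (Pih h g : H1 Ω))
    (uh φh : ℕ → H1 Ω) (hIPM : IsIPM (𝒯 h) k ν ρ f gh uh φh) :
    (∀ i : ℕ, 1 ≤ i →
      ‖grad u - grad (uh i)‖ ≤
        2 * (1 + cF) *
            (⨅ v : Xh (𝒯 h) k,
              ‖grad u - grad (v : H1 Ω)‖)
          + θ ^ (i - 1) *
            (⨅ v : Xh (𝒯 h) k,
              (c₁ * ‖grad u - grad (v : H1 Ω)‖
                + c₂ * ‖p + ρ • dvg (v : H1 Ω)‖))) ∧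
    (∀ i : ℕ, 1 ≤ i →
      ‖p - dvg (φh i)‖ ≤
        2 * ν * (1 + cF) * β⁻¹ *
            (⨅ v : Xh (𝒯 h) k,
              ‖grad u - grad (v : H1 Ω)‖)
          + (⨅ q : Qh (𝒯 h) k, ‖p - (q : L2 Ω ℝ)‖)
          + (ν + ρ * β) / β * θ ^ (i - 1) *
            (⨅ v : Xh (𝒯 h) k,
              (c₁ * ‖grad u - grad (v : H1 Ω)‖
                + c₂ * ‖p + ρ • dvg (v : H1 Ω)‖))) ∧
    Filter.Tendsto (fun i : ℕ => θ ^ (i - 1) *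
        (⨅ v : Xh (𝒯 h) k,
          (c₁ * ‖grad u - grad (v : H1 Ω)‖
            + c₂ * ‖p + ρ • dvg (v : H1 Ω)‖)))
      Filter.atTop (nhds 0) := by
  have hd := hdiv h
  have : FiniteDimensional ℝ (Xh (𝒯 h) k) :=
    finiteDimensional_Xh hΩ.isOpen hΩ.isBounded (𝒯 h) k
  have : FiniteDimensional ℝ (Vh (𝒯 h) k) := Submodule.finiteDimensional_of_le inf_le_left
  have hw : ∀ v ∈ Xh (𝒯 h) k, uh 1 - (v + Pih h (u - v)) ∈ Vh (𝒯 h) k := fun v hv =>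
    hΩ.sub_correction_mem_Vh (hPi.trace_discrete h) hup.boundary hghPi (hIPM.mem 0).1
      (hIPM.boundary 0) hv
  have hs : ∀ v ∈ Xh (𝒯 h) k, uh 1 - (v + Ih h (u - v)) ∈ Vh (𝒯 h) k := fun v hv =>
    hΩ.sub_correction_mem_Vh (hI.trace_discrete h) hup.boundary hghI (hIPM.mem 0).1
      (hIPM.boundary 0) hv
  have hU : ∀ i, uh (i + 1) - uh 1 ∈ Vh (𝒯 h) k := fun i =>
    hΩ.mem_Vh_of_zeroTrace (Submodule.sub_mem _ (hIPM.mem i).1 (hIPM.mem 0).1)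
      ((hIPM.boundary i).sub_mem_zeroTrace_of_sameTrace (hIPM.boundary 0))
  exact penalty_apriori_estimate (V := Vh (𝒯 h) k) (X := Xh (𝒯 h) k) (S := Qh (𝒯 h) k)
    (P := fun v => Pih h v) (I := fun v => Ih h v) hβ hν hρ hcF hcI hθ hc₁ hc₂
    (hinfsup.abstractInfSup hd) norm_dvg_le (fun q => (mem_Qh_iff hd).1)
    (fun i => dvg_mem_Qh (hIPM.mem i)) hU hIPM.init hIPM.update
    -- As `V_h` lies in `H10`, the continuous momentum equation eliminates `f`.
    (fun i v hv => (hIPM.velocity i v hv).trans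
      (congrArg (· + ⟪dvg (φh i), dvg v⟫) (hup.momentum ⟨v, hv.2⟩).symm))
    (hPi.stable h) (hI.stable h) hw
    (fun v hv => hPi.dvg_correction_eq_zero hd hu (hIPM.mem 0) (hw v hv)) hs
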